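/- Let $d\ge 1$, let $\mathbb T^d=(\mathbb R/2\pi\mathbb Z)^d$, and let $K\subset\mathbb R^d$ and $G\subset\mathbb R^d\times\mathbb R^d$ be open. Let $U$ be a $C^1$ potential on the set of positions $\{x:(x,p)\in G \text{ for some } p\}$, let $\omega\in C^2(K;\mathbb R^d)$ satisfy $\det D\omega(k)\ne 0$ for all $k\in K$, and let $N:\mathbb T^d\times K\to G$, $(q,k)\mapsto(x,p)$, be a $C^1$-diffeomorphism onto $G$ that passes from action-angle variables to position and momentum for the Hamiltonian $\frac{|p|^2}{2}+U(x)$, with frequencies $\omega$: in the coordinates $(q,k)$ Hamilton's equations $\dot x=p$, $\dot p=-\nabla U(x)$ read $\dot q=\omega(k)$, $\dot k=0$, and $N$ preserves Liouville measure, $|\det DN|=1$. Let $F_0\in C^1_c(G)$, extended by $0$ to $\mathbb R^d\times\mathbb R^d$ (so that $F_0\in L^1$, and $F_0$, $\nabla F_0$ are bounded). Let $F$ be the classical ($C^1$ on $\mathbb R\times G$) solution of Liouville's equation $$\partial_t F=-p\cdot\nabla_xF+\nabla U(x)\cdot\nabla_pF\quad\text{in }\mathbb R\times G,\qquad F(0)=F_0,$$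 extended by $0$ outside $G$, and let $$\widetilde F_0=\overline{(F_0\circ N)}\circ N^{-1}\ \text{ on } G,\qquad \widetilde F_0=0\ \text{ outside } G,\qquad \overline{f}(k)=\frac1{(2\pi)^d}\int_{\mathbb T^d}f(q,k)\,dq .$$ For a density $F$ on $\mathbb R^d\times\mathbb R^d$ let $M=\iint F\,dp\,dx$, and let its Coulomb potential $V_F$ be the $C^2$ solution of $$-\Delta V_F(x)=\int_{\mathbb R^d}F(x,p)\,dp\qquad (x\in\mathbb R^d)$$ normalized by: $V_F(x)\to0$ as $|x|\to\infty$ if $d\ge3$; $V_F(x)+\frac{M}{2\pi}\ln|x|\to0$ as $|x|\to\infty$ if $d=2$; $V_F(0)=0$ and $V_F(x)+\frac M2|x|$ bounded on $\mathbb R$ if $d=1$. Then $V_{F(t)}$ (for every $t\in\mathbb R$) and $V_{\widetilde F_0}$ exist and are unique, and there is a constant $C$ independent of $t$ with $$\|V_{F(t)}-V_{\widetilde F_0}\|_{L^\infty(\mathbb R^d)}\le\frac{C}{1+|t|}\qquad\text{for all }t\in\mathbb R .$$ -/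

import Mathlib

open Real Set Filter Topology MeasureTheory

noncomputable section

/-- Euclidean space `ℝ^d`. -/
abbrev Eucl (d : ℕ) : Type := EuclideanSpace ℝ (Fin d)

/-- Phase space `ℝ^d × ℝ^d` with points `(x, p)`. -/
abbrev Phase (d : ℕ) : Type := Eucl d × Eucl d

/-- The period `2π` of the angles is positive. -/
instance fact_two_pi_pos : Fact (0 < 2 * π) := ⟨Real.two_pi_pos⟩

/-- The flat torus `(ℝ / 2πℤ)^d`; its `volume` is the product of the arc lengths, of total
mass `(2π)^d`. -/
abbrev Torus (d : ℕ) : Type := Fin d → AddCircle (2 * π)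

/-- The covering map `ℝ^d → 𝕋^d`. -/
def torusProj (d : ℕ) (q : Eucl d) : Torus d := fun i => (q i : AddCircle (2 * π))

/-- The lift of a map on `𝕋^d × ℝ^d` to the covering space `ℝ^d × ℝ^d`. -/
def torusLift {d : ℕ} {β : Type*} (g : Torus d × Eucl d → β) : Eucl d × Eucl d → β :=
  fun y => g (torusProj d y.1, y.2)

/-- `N` restricts to a `C¹`-diffeomorphism from `𝕋^d × K` onto `G ⊆ ℝ^d × ℝ^d`: it is a
homeomorphism between these (open) sets, it is `C¹` in the angle coordinates, and its derivative is
invertible everywhere, so that by the inverse function theorem the inverse is `C¹` too. -/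
structure IsC1Diffeo {d : ℕ} (N : OpenPartialHomeomorph (Torus d × Eucl d) (Phase d))
    (K : Set (Eucl d)) (G : Set (Phase d)) : Prop where
  source_eq : N.source = univ ×ˢ K
  target_eq : N.target = G
  contDiffOn_lift : ContDiffOn ℝ 1 (torusLift N) (univ ×ˢ K)
  det_ne_zero : ∀ q : Eucl d, ∀ k ∈ K, (fderiv ℝ (torusLift N) (q, k)).det ≠ 0

/-- `N(q, k) = (x, p)` is the passage from action-angle variables to position and momentum, with
frequencies `ω`, for the Hamiltonian `|p|²/2 + U(x)`. In the coordinates `(q, k)` Hamilton's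
equations `x' = p`, `p' = -∇U(x)` read `q' = ω(k)`, `k' = 0`, and the Liouville measure `dx dp` is
`dq dk`. (A canonical transformation `N` with `H ∘ N = h(k)`, `ω = ∇h`, has both properties.) -/
structure IsActionAngle {d : ℕ} (U : Eucl d → ℝ) (ω : Eucl d → Eucl d)
    (N : Torus d × Eucl d → Phase d) (K : Set (Eucl d)) : Prop where
  hamilton : ∀ q : Eucl d, ∀ k ∈ K,
    fderiv ℝ (torusLift N) (q, k) (ω k, 0) =
      ((torusLift N (q, k)).2, -gradient U (torusLift N (q, k)).1)
  abs_det : ∀ q : Eucl d, ∀ k ∈ K, |(fderiv ℝ (torusLift N) (q, k)).det| = 1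

/-- `F` is the (classical) solution on `ℝ × G`, extended by zero outside `G`, of Liouville's equation
`∂ₜF = -p · ∇ₓF + ∇U(x) · ∇ₚF` with initial datum `F₀`. -/
structure IsLiouvilleSolution {d : ℕ} (U : Eucl d → ℝ) (G : Set (Phase d)) (F₀ : Phase d → ℝ)
    (F : ℝ → Phase d → ℝ) : Prop where
  contDiffOn : ContDiffOn ℝ 1 (fun s : ℝ × Phase d => F s.1 s.2) (univ ×ˢ G)
  eq_zero : ∀ t : ℝ, ∀ z ∉ G, F t z = 0
  initial : F 0 = F₀
  liouville : ∀ t : ℝ, ∀ x p : Eucl d, (x, p) ∈ G →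
    deriv (fun s => F s (x, p)) t =
      -inner ℝ p (gradient (fun x' => F t (x', p)) x)
        + inner ℝ (gradient U x) (gradient (fun p' => F t (x, p')) p)

/-- The spatial density `∫ F(x, p) dp`. -/
def spatialDensity {d : ℕ} (F : Phase d → ℝ) (x : Eucl d) : ℝ := ∫ p : Eucl d, F (x, p)

/-- `V` is the Coulomb potential of the phase-space density `F`: a classical solution of
`-ΔV = ρ` with `ρ(x) = ∫ F(x, p) dp`, which vanishes at infinity if `d ≥ 3`, which is asymptotic to
the potential `-(2π)⁻¹ M ln|x|` of the total mass `M` if `d = 2`, and which satisfies `V(0) = 0` and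
stays at bounded distance from `-M|x|/2` if `d = 1`. -/
structure IsCoulombPotential {d : ℕ} (F : Phase d → ℝ) (V : Eucl d → ℝ) : Prop where
  contDiff : ContDiff ℝ 2 V
  poisson : ∀ x : Eucl d, -Laplacian.laplacian V x = spatialDensity F x
  dim_one : d = 1 → V 0 = 0 ∧
    ∃ B : ℝ, ∀ x : Eucl d, |V x + (∫ y, spatialDensity F y) / 2 * ‖x‖| ≤ B
  dim_two : d = 2 →
    Tendsto (fun x : Eucl d => V x + (∫ y, spatialDensity F y) / (2 * π) * Real.log ‖x‖)
      (cocompact (Eucl d)) (𝓝 0)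
  dim_ge_three : 3 ≤ d → Tendsto V (cocompact (Eucl d)) (𝓝 0)

/-- The average over the angles `(2π)^{-d} ∫ f(q, k) dq`. -/
def angleAverage {d : ℕ} (f : Torus d × Eucl d → ℝ) (k : Eucl d) : ℝ :=
  ((2 * π) ^ d)⁻¹ * ∫ q : Torus d, f (q, k)

/-- The function `(average of F₀ ∘ N over the angles) ∘ N⁻¹` on the range `N.target` of the
action-angle map, extended by zero. -/
def averagedDensity {d : ℕ} (N : OpenPartialHomeomorph (Torus d × Eucl d) (Phase d))
    (F₀ : Phase d → ℝ) : Phase d → ℝ :=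
  N.target.indicator fun z => angleAverage (fun y => F₀ (N y)) (N.symm z).2

end

/-! In action-angle variables the solution is `f(q - tω(k), k)`, where `f = F₀ ∘ N`, and the claim
is a quantitative form of phase mixing.

Test this density against a function `h(q, k)`. Translating the angles of the density by a vector
`e` changes the integral by an average, over the partial translations `s • e` with `0 ≤ s ≤ 1`, of
integrals of `h` against the angular derivative of the density in the direction `e`. Since `Dω` is
invertible, the field `w = (Dω)⁻¹ e` on the actions moves the frequency in the direction `e`. The
derivative of `k ↦ f(q - tω(k), k)` along `w` is therefore `-t` times that angular derivative, plus
a bounded term. Solving for the angular derivative and integrating by parts in `k` puts the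
remaining derivative on `h w`, so the change is at most `C / (1 + |t|)` times the `W^{1,1}` norm of
`h` near the actions in the support (`abs_integral_mul_fderiv_shift_le`,
`abs_integral_shift_sub_le`). Averaging over all translations `e` in a period cell replaces the
density by its angle average (`abs_integral_sub_angleAverage_le`).

For the potential at `x` the test function is the Coulomb kernel `Φ(x - X)`, with `X` the position.
One derivative of `Φ` has size `|y|^{1-d}`, which is locally integrable, so `W^{1,1}` is just the
right norm. As `N` preserves Liouville measure, the norm in `(q, k)` is bounded by an integral over
a ball of positions. In dimensions one and two `Φ` is unbounded at infinity; but both densities have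
the same mass, so a constant depending on `x` may be subtracted from the kernel, and the bound
becomes uniform in `x` (`exists_liouville_mixing`, `exists_integral_coulombKernel_le`). The kernel
is regularized by `|y|² + ε` to make it an admissible `C¹` test function, with bounds independent of
`ε`.

It remains to identify the normalized potentials with these convolutions: existence follows from
Poisson's equation for `Φ * ρ` and far-field asymptotics, uniqueness from the maximum principle, and
in dimension one from the fact that harmonic functions on the line are affine. -/

noncomputable section

/-! ### The regularized Coulomb kernel: derivatives, bounds, integrability -/

/-- The reciprocal of the area of the unit sphere of `ℝ^d`. -/
def coulombConst (d : ℕ) : ℝ := (d * volume.real (Metric.ball (0 : Eucl d) 1))⁻¹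

lemma coulombConst_nonneg (d : ℕ) : 0 ≤ coulombConst d := by
  unfold coulombConst; positivity

lemma coulombConst_one : coulombConst 1 = 1 / 2 := by
  have h : volume.real (Metric.ball (0 : Eucl 1) 1) = 2 := by
    rw [Measure.real, EuclideanSpace.volume_ball]
    have h2 : Real.Gamma ((2 : ℝ)⁻¹ + 1) = √π / 2 := by
      rw [show (2 : ℝ)⁻¹ = 1 / 2 by norm_num, Real.Gamma_add_one (by norm_num),
        Real.Gamma_one_half_eq]
      ring
    have h3 : √π ≠ 0 := (Real.sqrt_pos.2 Real.pi_pos).ne'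
    simp [h2, h3]
  rw [coulombConst, h]; norm_num

lemma coulombConst_two : coulombConst 2 = 1 / (2 * π) := by
  have h : volume.real (Metric.ball (0 : Eucl 2) 1) = π := by
    rw [Measure.real, EuclideanSpace.volume_ball]
    have h2 : Real.Gamma (1 + 1) = 1 := by norm_num
    simp [h2, Real.sq_sqrt Real.pi_pos.le, ENNReal.toReal_ofReal Real.pi_pos.le]
  rw [coulombConst, h]; norm_num

/-- The Coulomb potential of a unit charge as a function of the squared distance. -/
def coulombProfile (d : ℕ) (u : ℝ) : ℝ :=
  if d = 1 then -√u / 2 else if d = 2 then -Real.log u / (4 * π)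
  else coulombConst d / (d - 2) * u ^ (1 - (d : ℝ) / 2)

/-- Only the antiderivative distinguishes dimensions one, two and higher. The derivative in the
squared distance is the same power law in all of them, so the field can be treated without case
distinctions. -/
lemma hasDerivAt_coulombProfile {d : ℕ} (hd : 1 ≤ d) {u : ℝ} (hu : 0 < u) :
    HasDerivAt (coulombProfile d) (-(coulombConst d / 2) * u ^ (-(d : ℝ) / 2)) u := by
  by_cases h1 : d = 1
  · subst h1
    have : coulombProfile 1 = fun u => -√u / 2 := by ext; simp [coulombProfile]
    rw [this, coulombConst_one]
    convert! ((hasDerivAt_id u).sqrt hu.ne').neg.div_const 2 using 1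
    rw [show (-((1 : ℕ) : ℝ) / 2) = -(1 / 2) by norm_num, Real.rpow_neg hu.le, ← Real.sqrt_eq_rpow]
    simp only [id]
    have := (Real.sqrt_pos.2 hu).ne'
    field_simp
  by_cases h2 : d = 2
  · subst h2
    have : coulombProfile 2 = fun u => -Real.log u / (4 * π) := by ext; simp [coulombProfile]
    rw [this, coulombConst_two]
    convert! (Real.hasDerivAt_log hu.ne').neg.div_const (4 * π) using 1
    rw [show (-((2 : ℕ) : ℝ) / 2) = -1 by norm_num, Real.rpow_neg_one]
    field_simp
    ring
  · have : coulombProfile d = fun u => coulombConst d / (d - 2) * u ^ (1 - (d : ℝ) / 2) := by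
      ext; simp [coulombProfile, h1, h2]
    rw [this]
    convert! (Real.hasDerivAt_rpow_const (p := 1 - (d : ℝ) / 2) (Or.inl hu.ne')).const_mul
      (coulombConst d / (d - 2)) using 1
    have h3 : (d : ℝ) - 2 ≠ 0 := by
      rw [sub_ne_zero]; exact_mod_cast h2
    rw [show (1 - (d : ℝ) / 2 - 1) = -(d : ℝ) / 2 by ring]
    field_simp
    ring

/-- The Coulomb kernel, regularized by `ε ≥ 0`; for `ε = 0` it is the fundamental solution. -/
def coulombKernel (d : ℕ) (ε : ℝ) (y : Eucl d) : ℝ := coulombProfile d (‖y‖ ^ 2 + ε)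

/-- The gradient of the regularized Coulomb kernel. -/
def coulombField (d : ℕ) (ε : ℝ) (y : Eucl d) : Eucl d :=
  (-(coulombConst d) * (‖y‖ ^ 2 + ε) ^ (-(d : ℝ) / 2)) • y

lemma hasFDerivAt_coulombKernel {d : ℕ} (hd : 1 ≤ d) {ε : ℝ} {y : Eucl d}
    (h : 0 < ‖y‖ ^ 2 + ε) :
    HasFDerivAt (coulombKernel d ε) (innerSL ℝ (coulombField d ε y)) y := by
  have h1 : HasFDerivAt (fun y : Eucl d => ‖y‖ ^ 2 + ε) (2 • innerSL ℝ y) y :=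
    (hasStrictFDerivAt_norm_sq y).hasFDerivAt.add_const ε
  have h2 := (hasDerivAt_coulombProfile hd h).comp_hasFDerivAt y h1
  convert! h2 using 1
  ext v
  simp [coulombField]
  ring

lemma measurable_coulombField (d : ℕ) (ε : ℝ) : Measurable (coulombField d ε) := by
  unfold coulombField; fun_prop

lemma measurable_coulombProfile (d : ℕ) : Measurable (coulombProfile d) := by
  unfold coulombProfile
  split_ifs <;> fun_prop

lemma measurable_coulombKernel (d : ℕ) (ε : ℝ) : Measurable (coulombKernel d ε) :=
  (measurable_coulombProfile d).comp (by fun_prop)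

/-- The exponent is nonpositive, so adding `ε` to `‖y‖ ^ 2` only decreases the power. This makes the
bound uniform in `ε`. -/
lemma norm_coulombField_le {d : ℕ} (hd : 1 ≤ d) {ε : ℝ} (hε : 0 ≤ ε) (y : Eucl d) :
    ‖coulombField d ε y‖ ≤ coulombConst d * (‖y‖ ^ (d - 1))⁻¹ := by
  have hc := coulombConst_nonneg d
  rcases eq_or_ne y 0 with rfl | hy
  · simp [coulombField]; positivity
  have hy' : 0 < ‖y‖ := norm_pos_iff.2 hy
  rw [coulombField, norm_smul, norm_mul, norm_neg, Real.norm_of_nonneg hc,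
    Real.norm_of_nonneg (by positivity), mul_assoc]
  refine mul_le_mul_of_nonneg_left ?_ hc
  have h1 : (‖y‖ ^ 2 + ε) ^ (-(d : ℝ) / 2) ≤ (‖y‖ ^ 2) ^ (-(d : ℝ) / 2) :=
    Real.rpow_le_rpow_of_nonpos (by positivity) (by linarith)
      (by have : (0 : ℝ) ≤ d := by positivity
          linarith)
  have h2 : (‖y‖ ^ 2) ^ (-(d : ℝ) / 2) = (‖y‖ ^ d)⁻¹ := by
    rw [← Real.rpow_natCast ‖y‖ 2, ← Real.rpow_mul hy'.le,
      show ((2 : ℕ) : ℝ) * (-(d : ℝ) / 2) = -(d : ℝ) by push_cast; ring, Real.rpow_neg hy'.le,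
      Real.rpow_natCast]
  calc _ ≤ (‖y‖ ^ d)⁻¹ * ‖y‖ := by rw [← h2]; gcongr
    _ = _ := by
      obtain ⟨n, rfl⟩ : ∃ n, d = n + 1 := ⟨d - 1, by omega⟩
      simp only [Nat.add_sub_cancel]
      rw [pow_succ]; field_simp

/-- A locally integrable weight that dominates the regularized kernels and their gradients. -/
def coulombWeight (d : ℕ) (y : Eucl d) : ℝ := 1 + ‖y‖ + (‖y‖ ^ (d - 1))⁻¹

lemma coulombWeight_nonneg (d : ℕ) (y : Eucl d) : 0 ≤ coulombWeight d y := by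
  unfold coulombWeight; positivity

lemma norm_coulombField_le_weight {d : ℕ} (hd : 1 ≤ d) {ε : ℝ} (hε : 0 ≤ ε) (y : Eucl d) :
    ‖coulombField d ε y‖ ≤ coulombConst d * coulombWeight d y := by
  refine (norm_coulombField_le hd hε y).trans
    (mul_le_mul_of_nonneg_left ?_ (coulombConst_nonneg d))
  unfold coulombWeight
  have := norm_nonneg y
  linarith

/-- The linear term of the weight absorbs the growth at infinity in dimensions one and two, the
negative power absorbs the singularity. The origin is excluded because for `2 ≤ d` the convention
`0⁻¹ = 0` makes the weight equal to `1` there, while the regularized kernel blows up as `ε → 0`. -/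
lemma exists_abs_coulombKernel_le {d : ℕ} (hd : 1 ≤ d) :
    ∃ C : ℝ, 0 ≤ C ∧ ∀ ε ∈ Icc (0 : ℝ) 1, ∀ y : Eucl d, y ≠ 0 →
      |coulombKernel d ε y| ≤ C * coulombWeight d y := by
  by_cases h1 : d = 1
  · subst h1
    refine ⟨1, by norm_num, fun ε hε y hy => ?_⟩
    have h : √(‖y‖ ^ 2 + ε) ≤ 1 + ‖y‖ := by
      apply Real.sqrt_le_iff.2 ⟨by positivity, ?_⟩
      nlinarith [norm_nonneg y, hε.2]
    have h0 := Real.sqrt_nonneg (‖y‖ ^ 2 + ε)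
    simp only [coulombKernel, coulombProfile, if_true, coulombWeight]
    rw [abs_div, abs_neg, abs_of_nonneg h0, abs_of_pos (by norm_num : (0 : ℝ) < 2)]
    simp
    linarith
  by_cases h2 : d = 2
  · subst h2
    refine ⟨(4 * π)⁻¹ * 2, by positivity, fun ε hε y hy => ?_⟩
    have hy' : 0 < ‖y‖ := norm_pos_iff.2 hy
    set u := ‖y‖ ^ 2 + ε with hu
    have hu0 : 0 < u := by have := hε.1; positivity
    have h3 : |Real.log u| ≤ 2 * coulombWeight 2 y := by
      have hl : Real.log u = 2 * Real.log (√u) := by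
        rw [Real.log_sqrt hu0.le]; ring
      have hs : √u ≤ 1 + ‖y‖ := by
        apply Real.sqrt_le_iff.2 ⟨by positivity, ?_⟩
        nlinarith [norm_nonneg y, hε.2]
      have hs0 : ‖y‖ ≤ √u := Real.le_sqrt_of_sq_le (by have := hε.1; linarith)
      have hsp : 0 < √u := Real.sqrt_pos.2 hu0
      have ha := Real.log_le_sub_one_of_pos hsp
      have hb := Real.log_le_sub_one_of_pos (inv_pos.2 hsp)
      rw [Real.log_inv] at hb
      have hc : (√u)⁻¹ ≤ ‖y‖⁻¹ := by gcongr
      have hd : 0 < ‖y‖⁻¹ := by positivity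
      simp only [coulombWeight]
      norm_num
      rw [hl, abs_le]
      constructor <;> linarith
    simp only [coulombKernel, coulombProfile]
    norm_num
    rw [← hu, abs_div, abs_neg, abs_of_pos (by positivity : 0 < 4 * π), div_eq_inv_mul]
    calc (4 * π)⁻¹ * |Real.log u| ≤ (4 * π)⁻¹ * (2 * coulombWeight 2 y) := by gcongr
      _ = _ := by field_simp
  · have hd3 : 3 ≤ d := by omega
    have hd3' : (3 : ℝ) ≤ d := by exact_mod_cast hd3
    have hc := coulombConst_nonneg d
    have hcc : 0 ≤ coulombConst d / (d - 2) := div_nonneg hc (by linarith)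
    refine ⟨coulombConst d / (d - 2), hcc, fun ε hε y hy => ?_⟩
    have hy' : 0 < ‖y‖ := norm_pos_iff.2 hy
    simp only [coulombKernel, coulombProfile, h1, h2, if_false]
    have hnn : 0 ≤ (‖y‖ ^ 2 + ε) ^ (1 - (d : ℝ) / 2) := by have := hε.1; positivity
    rw [abs_of_nonneg (mul_nonneg hcc hnn)]
    refine mul_le_mul_of_nonneg_left ?_ hcc
    have h3 : (‖y‖ ^ 2 + ε) ^ (1 - (d : ℝ) / 2) ≤ (‖y‖ ^ 2) ^ (1 - (d : ℝ) / 2) :=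
      Real.rpow_le_rpow_of_nonpos (by positivity) (by linarith [hε.1]) (by linarith)
    have h4 : (‖y‖ ^ 2) ^ (1 - (d : ℝ) / 2) = (‖y‖ ^ (d - 2))⁻¹ := by
      rw [← Real.rpow_natCast ‖y‖ 2, ← Real.rpow_mul hy'.le,
        show ((2 : ℕ) : ℝ) * (1 - (d : ℝ) / 2) = -((d - 2 : ℕ) : ℝ) by
          rw [Nat.cast_sub (by omega)]; push_cast; ring, Real.rpow_neg hy'.le,
        Real.rpow_natCast]
    refine h3.trans (h4.le.trans ?_)
    unfold coulombWeight
    rcases le_total 1 ‖y‖ with h | h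
    · have : (‖y‖ ^ (d - 2))⁻¹ ≤ 1 := inv_le_one_of_one_le₀ (one_le_pow₀ h)
      have h5 : 0 ≤ (‖y‖ ^ (d - 1))⁻¹ := by positivity
      linarith
    · have : (‖y‖ ^ (d - 2))⁻¹ ≤ (‖y‖ ^ (d - 1))⁻¹ := by
        apply inv_anti₀ (by positivity)
        exact pow_le_pow_of_le_one hy'.le h (by omega)
      linarith

/-- Mean value inequality on the ball of radius `R` about `x`, whose points have norm at least `‖x‖
- R`. It serves both the far-field asymptotics of the potentials and the bounds that are uniform in
the observation point. -/
lemma abs_coulombKernel_sub_le {d : ℕ} (hd : 1 ≤ d) {ε R : ℝ} (hε : 0 ≤ ε) {x y : Eucl d}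
    (hy : ‖y‖ ≤ R) (hx : R < ‖x‖) :
    |coulombKernel d ε (x - y) - coulombKernel d ε x| ≤
      coulombConst d * ((‖x‖ - R) ^ (d - 1))⁻¹ * R := by
  have hc := coulombConst_nonneg d
  have hR : 0 ≤ R := (norm_nonneg y).trans hy
  have hn : ∀ z ∈ Metric.closedBall x R, ‖x‖ - R ≤ ‖z‖ := by
    intro z hz
    have h1 : ‖x - z‖ ≤ R := by rw [← dist_eq_norm, dist_comm]; exact hz
    have h2 := norm_sub_norm_le x z
    linarith
  have key := (convex_closedBall x R).norm_image_sub_le_of_norm_hasFDerivWithin_le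
    (f := coulombKernel d ε) (f' := fun z => innerSL ℝ (coulombField d ε z))
    (C := coulombConst d * ((‖x‖ - R) ^ (d - 1))⁻¹) (x := x) (y := x - y)
    (fun z hz => (hasFDerivAt_coulombKernel hd (by
      have h1 := hn z hz
      have : 0 < ‖z‖ := by linarith
      positivity)).hasFDerivWithinAt)
    (fun z hz => by
      rw [innerSL_apply_norm]
      refine (norm_coulombField_le hd hε z).trans (mul_le_mul_of_nonneg_left ?_ hc)
      have h1 := hn z hz
      have h0 : 0 < ‖x‖ - R := by linarith
      gcongr) (Metric.mem_closedBall_self hR) (by simpa [dist_eq_norm] using hy)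
  rw [Real.norm_eq_abs] at key
  refine key.trans ?_
  have h0 : 0 ≤ coulombConst d * ((‖x‖ - R) ^ (d - 1))⁻¹ := by
    have : 0 < ‖x‖ - R := by linarith
    positivity
  refine mul_le_mul_of_nonneg_left ?_ h0
  simpa using hy

/-- In polar coordinates the Jacobian `s ^ (d - 1)` cancels the weight exactly. -/
lemma integrableOn_inv_norm_pow {d : ℕ} (hd : 1 ≤ d) (r : ℝ) :
    IntegrableOn (fun y : Eucl d => (‖y‖ ^ (d - 1))⁻¹) (Metric.ball 0 r) := by
  have : Nonempty (Fin d) := ⟨⟨0, hd⟩⟩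
  rw [integrableOn_fun_norm_addHaar volume (f := fun s => (s ^ (d - 1))⁻¹)]
  have : IntegrableOn (fun _ : ℝ => (1 : ℝ)) (Ioo 0 r) := integrableOn_const (by simp)
  refine this.congr_fun (fun s hs => ?_) measurableSet_Ioo
  have : s ≠ 0 := hs.1.ne'
  simp [this]

lemma locallyIntegrable_coulombWeight {d : ℕ} (hd : 1 ≤ d) :
    LocallyIntegrable (coulombWeight d) := by
  rw [locallyIntegrable_iff]
  intro k hk
  obtain ⟨r, hr⟩ := hk.isBounded.subset_ball 0
  have h1 : IntegrableOn (fun y : Eucl d => 1 + ‖y‖) k :=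
    (by fun_prop : Continuous fun y : Eucl d => 1 + ‖y‖).continuousOn.integrableOn_compact hk
  exact h1.add ((integrableOn_inv_norm_pow hd r).mono_set hr)

lemma locallyIntegrable_coulombKernel {d : ℕ} (hd : 1 ≤ d) {ε : ℝ} (hε : ε ∈ Icc (0 : ℝ) 1) :
    LocallyIntegrable (coulombKernel d ε) := by
  have : Nonempty (Fin d) := ⟨⟨0, hd⟩⟩
  obtain ⟨C, hC, h⟩ := exists_abs_coulombKernel_le hd
  refine ((locallyIntegrable_coulombWeight hd).smul C).mono
    (measurable_coulombKernel d ε).aestronglyMeasurable ?_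
  have h0 : ∀ᵐ y : Eucl d, y ≠ 0 := by simp [ae_iff]
  filter_upwards [h0] with y hy
  have := h ε hε y hy
  simp only [Pi.smul_apply, smul_eq_mul, Real.norm_eq_abs]
  rwa [abs_of_nonneg (mul_nonneg hC (coulombWeight_nonneg d y))]

lemma locallyIntegrable_coulombField {d : ℕ} (hd : 1 ≤ d) {ε : ℝ} (hε : 0 ≤ ε) :
    LocallyIntegrable (coulombField d ε) := by
  refine ((locallyIntegrable_coulombWeight hd).smul (coulombConst d)).mono
    (measurable_coulombField d ε).aestronglyMeasurable (ae_of_all _ fun y => ?_)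
  have := norm_coulombField_le_weight hd hε y
  simp only [Pi.smul_apply, smul_eq_mul, Real.norm_eq_abs]
  rwa [abs_of_nonneg (mul_nonneg (coulombConst_nonneg d) (coulombWeight_nonneg d y))]

/-- The weight is integrable over balls, uniformly in their centre up to linear growth. -/
lemma exists_setIntegral_inv_norm_pow_le {d : ℕ} (hd : 1 ≤ d) (R : ℝ) :
    ∃ C : ℝ, 0 ≤ C ∧ ∀ x : Eucl d,
      IntegrableOn (fun y => (‖x - y‖ ^ (d - 1))⁻¹) (Metric.closedBall 0 R) ∧
      ∫ y in Metric.closedBall (0 : Eucl d) R, (‖x - y‖ ^ (d - 1))⁻¹ ≤ C := by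
  have hi := integrableOn_inv_norm_pow hd 1
  -- The singular part is cut off to the unit ball, where its integral is translation invariant;
  -- outside that ball the power is at most `1`.
  set b : Eucl d → ℝ := (Metric.ball (0 : Eucl d) 1).indicator fun y => (‖y‖ ^ (d - 1))⁻¹ with hb
  have hbi : Integrable b := (integrable_indicator_iff measurableSet_ball).2 hi
  have hb0 : ∀ y, 0 ≤ b y := fun y => indicator_nonneg (fun z _ => by positivity) y
  have hle : ∀ y : Eucl d, (‖y‖ ^ (d - 1))⁻¹ ≤ b y + 1 := by
    intro y
    by_cases hy : y ∈ Metric.ball (0 : Eucl d) 1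
    · simp [hb, hy]
    · have : 1 ≤ ‖y‖ := by simpa using hy
      have h1 : (‖y‖ ^ (d - 1))⁻¹ ≤ 1 := inv_le_one_of_one_le₀ (one_le_pow₀ this)
      linarith [hb0 y]
  have hfin : volume (Metric.closedBall (0 : Eucl d) R) ≠ ⊤ := measure_closedBall_lt_top.ne
  refine ⟨(∫ y, b y) + volume.real (Metric.closedBall (0 : Eucl d) R),
    add_nonneg (integral_nonneg hb0) measureReal_nonneg, fun x => ?_⟩
  have hbx : Integrable fun y => b (x - y) := hbi.comp_sub_left x
  have hsum : IntegrableOn (fun y => b (x - y) + 1) (Metric.closedBall 0 R) :=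
    hbx.integrableOn.add (integrableOn_const hfin)
  have hint : IntegrableOn (fun y => (‖x - y‖ ^ (d - 1))⁻¹) (Metric.closedBall 0 R) := by
    refine hsum.mono' (by fun_prop) (ae_of_all _ fun y => ?_)
    rw [Real.norm_of_nonneg (by positivity)]
    exact hle _
  refine ⟨hint, (integral_mono hint hsum fun y => hle _).trans ?_⟩
  rw [integral_add hbx.integrableOn (integrableOn_const hfin)]
  refine add_le_add ?_ (by simp)
  calc ∫ y in Metric.closedBall 0 R, b (x - y) ≤ ∫ y, b (x - y) :=
        setIntegral_le_integral hbx (ae_of_all _ fun y => hb0 _)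
    _ = ∫ y, b y := integral_sub_left_eq_self b volume x

/-! ### The kernel as fundamental solution, and Poisson's equation -/

lemma coulombKernel_tendsto {d : ℕ} (hd : 1 ≤ d) {y : Eucl d} (hy : y ≠ 0) :
    Tendsto (fun n : ℕ => coulombKernel d (1 / ((n : ℝ) + 1)) y) atTop (𝓝 (coulombKernel d 0 y)) := by
  have hy' : 0 < ‖y‖ ^ 2 + 0 := by have := norm_pos_iff.2 hy; positivity
  refine (hasDerivAt_coulombProfile hd hy').continuousAt.tendsto.comp ?_
  exact tendsto_const_nhds.add tendsto_one_div_add_atTop_nhds_zero_nat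

lemma coulombField_tendsto {d : ℕ} {y : Eucl d} (hy : y ≠ 0) :
    Tendsto (fun n : ℕ => coulombField d (1 / ((n : ℝ) + 1)) y) atTop (𝓝 (coulombField d 0 y)) := by
  have hy' : ‖y‖ ^ 2 + 0 ≠ 0 := by have := norm_pos_iff.2 hy; positivity
  refine Tendsto.smul_const (Tendsto.const_mul _ ?_) y
  refine (Real.continuousAt_rpow_const _ (-(d : ℝ) / 2) (Or.inl hy')).tendsto.comp ?_
  exact tendsto_const_nhds.add tendsto_one_div_add_atTop_nhds_zero_nat

lemma integrable_mul_of_locallyIntegrable {d : ℕ} {f g : Eucl d → ℝ} (hf : LocallyIntegrable f)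
    (hg : Continuous g) (hgc : HasCompactSupport g) : Integrable fun y => f y * g y :=
  hf.integrable_smul_right_of_hasCompactSupport hg hgc

lemma HasCompactSupport.comp_const_sub {d : ℕ} {β : Type*} [Zero β] {ρ : Eucl d → β}
    (hρ : HasCompactSupport ρ) (x : Eucl d) : HasCompactSupport fun y => ρ (x - y) :=
  hρ.comp_homeomorph (Homeomorph.subLeft x)

lemma fderiv_comp_const_sub {d : ℕ} {ρ : Eucl d → ℝ} (hρ : ContDiff ℝ 1 ρ) (x y : Eucl d) :
    fderiv ℝ (fun y => ρ (x - y)) y = -fderiv ℝ ρ (x - y) := by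
  have h := ((hρ.differentiable one_ne_zero).differentiableAt (x := x - y)).hasFDerivAt.comp y
    ((hasFDerivAt_id y).const_sub x)
  refine (HasFDerivAt.fderiv h).trans ?_
  ext v; simp

/-- Polar coordinates: the Coulomb field is the field of a unit point charge at the origin. -/
lemma integral_fderiv_coulombField {d : ℕ} (hd : 1 ≤ d) {φ : Eucl d → ℝ} (hφ : ContDiff ℝ 1 φ)
    (hφc : HasCompactSupport φ) : ∫ y, fderiv ℝ φ y (coulombField d 0 y) = φ 0 := by
  have : Nonempty (Fin d) := ⟨⟨0, hd⟩⟩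
  have hDc : Continuous (fderiv ℝ φ) := hφ.continuous_fderiv one_ne_zero
  set G : Eucl d → ℝ := fun y => fderiv ℝ φ y (coulombField d 0 y) with hG
  have hGi : Integrable G := by
    have h1 : Integrable fun y => ‖fderiv ℝ φ y‖ • coulombField d 0 y :=
      (locallyIntegrable_coulombField hd le_rfl).integrable_smul_left_of_hasCompactSupport
        hDc.norm (hφc.fderiv ℝ).norm
    refine h1.mono ?_ (ae_of_all _ fun y => ?_)
    · have hm : Measurable (fderiv ℝ φ) := hDc.measurable
      have h2 := measurable_coulombField d 0
      exact (isBoundedBilinearMap_apply.continuous.measurable.comp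
        (hm.prodMk h2)).aestronglyMeasurable
    · rw [norm_smul, norm_norm]
      exact (fderiv ℝ φ y).le_opNorm _
  have hmp := (volume : Measure (Eucl d)).measurePreserving_homeomorphUnitSphereProd
  have hemb := (homeomorphUnitSphereProd (Eucl d)).measurableEmbedding
  have hrank : Module.finrank ℝ (Eucl d) = d := by simp
  rw [hrank] at hmp
  have hval : ∀ z : ({0}ᶜ : Set (Eucl d)),
      (((homeomorphUnitSphereProd (Eucl d) z).2 : ℝ) •
        ((homeomorphUnitSphereProd (Eucl d) z).1 : Eucl d)) = z := by
    intro z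
    have h0 : ‖(z : Eucl d)‖ ≠ 0 := norm_ne_zero_iff.2 z.2
    simp [smul_smul, h0]
  set H : Metric.sphere (0 : Eucl d) 1 × Ioi (0 : ℝ) → ℝ :=
    fun p => G ((p.2 : ℝ) • (p.1 : Eucl d)) with hH
  have hcomp : (fun z : ({0}ᶜ : Set (Eucl d)) => H (homeomorphUnitSphereProd (Eucl d) z)) =
      fun z : ({0}ᶜ : Set (Eucl d)) => G z := by
    ext z; simp only [hH]; rw [hval z]
  have e1 : ∫ y, G y = ∫ p, H p ∂(volume : Measure (Eucl d)).toSphere.prod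
      (Measure.volumeIoiPow (d - 1)) := by
    rw [← hmp.integral_comp hemb, hcomp,
      integral_subtype_comap (measurableSet_singleton _).compl G, restrict_compl_singleton]
  have hHi : Integrable H ((volume : Measure (Eucl d)).toSphere.prod
      (Measure.volumeIoiPow (d - 1))) := by
    rw [← hmp.integrable_comp_emb hemb]
    change Integrable (fun z => H (homeomorphUnitSphereProd (Eucl d) z)) _
    rw [hcomp]
    have := integrableOn_iff_comap_subtypeVal (μ := (volume : Measure (Eucl d))) (f := G)
      (s := ({0}ᶜ : Set (Eucl d))) (measurableSet_singleton _).compl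
    exact this.1 hGi.integrableOn
  have inner_eq : ∀ θ : Metric.sphere (0 : Eucl d) 1,
      ∫ r : Ioi (0 : ℝ), H (θ, r) ∂(Measure.volumeIoiPow (d - 1)) = coulombConst d * φ 0 := by
    intro θ
    have hθ : ‖(θ : Eucl d)‖ = 1 := by simp
    set ψ : ℝ → ℝ := fun r => φ (r • (θ : Eucl d)) with hψ
    have hψd : ContDiff ℝ 1 ψ := hφ.comp (contDiff_id.smul contDiff_const)
    have hψc : HasCompactSupport ψ := by
      refine hφc.comp_isClosedEmbedding (isClosedEmbedding_smul_left ?_)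
      intro h; simp [h] at hθ
    have hderiv : ∀ r, deriv ψ r = fderiv ℝ φ (r • (θ : Eucl d)) θ := by
      intro r
      have h1 := ((hφ.differentiable one_ne_zero).differentiableAt
        (x := r • (θ : Eucl d))).hasFDerivAt.comp_hasDerivAt r
          ((hasDerivAt_id r).smul_const (θ : Eucl d))
      exact (HasDerivAt.deriv h1).trans (by simp)
    have hmain := hψc.integral_Ioi_deriv_eq hψd 0
    simp only [Measure.volumeIoiPow, ENNReal.ofReal]
    rw [integral_withDensity_eq_integral_smul
      ((measurable_subtype_coe.pow_const _).real_toNNReal),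
      integral_subtype_comap measurableSet_Ioi
        fun r => Real.toNNReal (r ^ (d - 1)) • G (r • (θ : Eucl d))]
    -- Along a ray, the Jacobian `r ^ (d - 1)` times the field strength `r * (r ^ 2) ^ (-d / 2)`
    -- equals `1`, so the integrand is an exact radial derivative and only the value at the origin
    -- survives.
    calc ∫ r in Ioi (0 : ℝ), Real.toNNReal (r ^ (d - 1)) • G (r • (θ : Eucl d))
        = ∫ r in Ioi (0 : ℝ), -(coulombConst d) * deriv ψ r := by
          refine setIntegral_congr_fun measurableSet_Ioi fun r hr => ?_
          have hr0 : (0 : ℝ) < r := hr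
          rw [NNReal.smul_def, Real.coe_toNNReal _ (pow_nonneg hr0.le _), hderiv]
          simp only [hG, coulombField, norm_smul, hθ, mul_one, add_zero, map_smul, smul_eq_mul,
            Real.norm_of_nonneg hr0.le]
          have h2 : (r ^ 2) ^ (-(d : ℝ) / 2) = (r ^ d)⁻¹ := by
            rw [← Real.rpow_natCast r 2, ← Real.rpow_mul hr0.le,
              show ((2 : ℕ) : ℝ) * (-(d : ℝ) / 2) = -(d : ℝ) by push_cast; ring,
              Real.rpow_neg hr0.le, Real.rpow_natCast]
          rw [h2]
          obtain ⟨n, rfl⟩ : ∃ n, d = n + 1 := ⟨d - 1, by omega⟩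
          simp only [Nat.add_sub_cancel]
          rw [pow_succ]; field_simp
      _ = coulombConst d * φ 0 := by
          rw [integral_const_mul, hmain]; simp [hψ]
  rw [e1, integral_prod _ hHi]
  simp only [inner_eq, integral_const, smul_eq_mul]
  -- The sphere has area `d` times the volume of the unit ball, which is the inverse of
  -- `coulombConst d`.
  rw [Measure.toSphere_real_apply_univ, hrank, coulombConst]
  have hpos : 0 < volume.real (Metric.ball (0 : Eucl d) 1) :=
    ENNReal.toReal_pos (Metric.measure_ball_pos _ _ one_pos).ne' measure_ball_lt_top.ne
  have hd0 : (d : ℝ) ≠ 0 := by positivity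
  field_simp

/-- Integration by parts against the Coulomb kernel. -/
lemma integral_coulombKernel_fderiv {d : ℕ} (hd : 1 ≤ d) {ρ : Eucl d → ℝ} (hρ : ContDiff ℝ 1 ρ)
    (hρc : HasCompactSupport ρ) (x v : Eucl d) :
    ∫ y, coulombKernel d 0 y * fderiv ℝ ρ (x - y) v =
      ∫ y, inner ℝ (coulombField d 0 y) v * ρ (x - y) := by
  have : Nonempty (Fin d) := ⟨⟨0, hd⟩⟩
  have hDc : Continuous (fderiv ℝ ρ) := hρ.continuous_fderiv one_ne_zero
  obtain ⟨C, hC, hCb⟩ := exists_abs_coulombKernel_le hd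
  have hεmem : ∀ n : ℕ, 1 / ((n : ℝ) + 1) ∈ Icc (0 : ℝ) 1 := fun n =>
    ⟨by positivity, by rw [div_le_one (by positivity)]; linarith [n.cast_nonneg (α := ℝ)]⟩
  have h0 : ∀ᵐ y : Eucl d, y ≠ 0 := by simp [ae_iff]
  have c1 : Continuous fun y => fderiv ℝ ρ (x - y) v := by fun_prop
  have s1 : HasCompactSupport fun y => fderiv ℝ ρ (x - y) v :=
    ((hρc.fderiv ℝ).comp_const_sub x).comp_left (g := fun L : Eucl d →L[ℝ] ℝ => L v) rfl
  have c2 : Continuous fun y => ρ (x - y) := by fun_prop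
  have s2 : HasCompactSupport fun y => ρ (x - y) := hρc.comp_const_sub x
  have hw := locallyIntegrable_coulombWeight hd
  have hfield : ∀ n : ℕ, LocallyIntegrable fun y =>
      inner ℝ (coulombField d (1 / ((n : ℝ) + 1)) y) v := by
    intro n
    have := (locallyIntegrable_coulombField hd (hεmem n).1)
    refine (this.smul ‖v‖).mono ?_ ?_
    · exact ((measurable_coulombField d _).inner_const).aestronglyMeasurable
    · refine ae_of_all _ fun y => ?_
      rw [Pi.smul_apply, norm_smul, norm_norm, mul_comm]
      exact norm_inner_le_norm _ _
  -- For positive `ε` the kernel is differentiable everywhere and the usual integration by parts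
  -- applies. Both sides then pass to the limit by dominated convergence, with `coulombWeight` as
  -- majorant.
  have hn : ∀ n : ℕ, ∫ y, coulombKernel d (1 / ((n : ℝ) + 1)) y * fderiv ℝ ρ (x - y) v =
      ∫ y, inner ℝ (coulombField d (1 / ((n : ℝ) + 1)) y) v * ρ (x - y) := by
    intro n
    have hpos : ∀ y : Eucl d, 0 < ‖y‖ ^ 2 + 1 / ((n : ℝ) + 1) := fun y => by positivity
    have hker := locallyIntegrable_coulombKernel hd (hεmem n)
    have hfd : ∀ y, fderiv ℝ (coulombKernel d (1 / ((n : ℝ) + 1))) y v =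
        inner ℝ (coulombField d (1 / ((n : ℝ) + 1)) y) v := fun y => by
      rw [(hasFDerivAt_coulombKernel hd (hpos y)).fderiv]; simp
    have key := integral_mul_fderiv_eq_neg_fderiv_mul_of_integrable (μ := volume)
      (f := coulombKernel d (1 / ((n : ℝ) + 1))) (g := fun y => ρ (x - y)) (v := v)
      (by simp only [hfd]; exact integrable_mul_of_locallyIntegrable (hfield n) c2 s2)
      (by
        simp only [fderiv_comp_const_sub hρ]
        simpa using (integrable_mul_of_locallyIntegrable hker c1 s1).neg)
      (integrable_mul_of_locallyIntegrable hker c2 s2)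
      (fun y _ => (hasFDerivAt_coulombKernel hd (hpos y)).differentiableAt)
      (fun y _ => ((hρ.comp (contDiff_const.sub contDiff_id)).differentiable
        one_ne_zero).differentiableAt)
    simp only [fderiv_comp_const_sub hρ, hfd, neg_apply, mul_neg,
      integral_neg] at key
    linarith
  have t1 : Tendsto (fun n : ℕ => ∫ y, coulombKernel d (1 / ((n : ℝ) + 1)) y *
      fderiv ℝ ρ (x - y) v) atTop (𝓝 (∫ y, coulombKernel d 0 y * fderiv ℝ ρ (x - y) v)) := by
    refine tendsto_integral_of_dominated_convergence
      (fun y => C * ‖coulombWeight d y * fderiv ℝ ρ (x - y) v‖)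
      (fun n => ((measurable_coulombKernel d _).mul c1.measurable).aestronglyMeasurable)
      ((integrable_mul_of_locallyIntegrable hw c1 s1).norm.const_mul C) (fun n => ?_) ?_
    · filter_upwards [h0] with y hy
      rw [norm_mul, norm_mul, ← mul_assoc, Real.norm_of_nonneg (coulombWeight_nonneg d y)]
      exact mul_le_mul_of_nonneg_right (hCb _ (hεmem n) y hy) (norm_nonneg _)
    · filter_upwards [h0] with y hy
      exact (coulombKernel_tendsto hd hy).mul_const _
  have t2 : Tendsto (fun n : ℕ => ∫ y, inner ℝ (coulombField d (1 / ((n : ℝ) + 1)) y) v *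
      ρ (x - y)) atTop (𝓝 (∫ y, inner ℝ (coulombField d 0 y) v * ρ (x - y))) := by
    refine tendsto_integral_of_dominated_convergence
      (fun y => (coulombConst d * ‖v‖) * ‖coulombWeight d y * ρ (x - y)‖)
      (fun n => (((measurable_coulombField d _).inner_const).mul
        c2.measurable).aestronglyMeasurable)
      ((integrable_mul_of_locallyIntegrable hw c2 s2).norm.const_mul _) (fun n => ?_) ?_
    · refine ae_of_all _ fun y => ?_
      rw [norm_mul, norm_mul, ← mul_assoc, Real.norm_of_nonneg (coulombWeight_nonneg d y)]
      refine mul_le_mul_of_nonneg_right ?_ (norm_nonneg _)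
      refine (norm_inner_le_norm _ _).trans ?_
      have := mul_le_mul_of_nonneg_right (norm_coulombField_le_weight hd (hεmem n).1 y)
        (norm_nonneg v)
      linarith
    · filter_upwards [h0] with y hy
      exact ((coulombField_tendsto hy).inner tendsto_const_nhds).mul_const _
  exact tendsto_nhds_unique t1 ((tendsto_congr hn).2 t2)

/-- The convolution of a density with the fundamental solution of `-Δ`. -/
def coulombPotential {d : ℕ} (ρ : Eucl d → ℝ) (x : Eucl d) : ℝ :=
  ∫ y, coulombKernel d 0 y * ρ (x - y)

lemma coulombPotential_eq {d : ℕ} (ρ : Eucl d → ℝ) (x : Eucl d) :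
    coulombPotential ρ x = ∫ y, coulombKernel d 0 (x - y) * ρ y := by
  have := integral_sub_left_eq_self (fun y => coulombKernel d 0 y * ρ (x - y)) volume x
  rw [coulombPotential, ← this]
  simp

/-- The second derivatives of the kernel are not locally integrable, so the two derivatives are
shared: one is moved onto the kernel, which gives the convolution `J` of the field with `ρ`, and the
other falls on `ρ`. Hence a `C¹` density already has a `C²` potential. The Laplacian is the field
paired with the gradient of `ρ`, which the point-charge identity evaluates. -/
lemma coulombPotential_contDiff_laplacian {d : ℕ} (hd : 1 ≤ d) {ρ : Eucl d → ℝ}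
    (hρ : ContDiff ℝ 1 ρ) (hρc : HasCompactSupport ρ) :
    ContDiff ℝ 2 (coulombPotential ρ) ∧
      ∀ x, -Laplacian.laplacian (coulombPotential ρ) x = ρ x := by
  have hDc : Continuous (fderiv ℝ ρ) := hρ.continuous_fderiv one_ne_zero
  have hker : LocallyIntegrable (coulombKernel d 0) :=
    locallyIntegrable_coulombKernel hd ⟨le_rfl, zero_le_one⟩
  set fE : Eucl d → (Eucl d →L[ℝ] ℝ) := fun y => innerSL ℝ (coulombField d 0 y) with hfE
  have hfEl : LocallyIntegrable fE := by
    refine (locallyIntegrable_coulombField hd le_rfl).mono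
      ((innerSL ℝ).continuous.measurable.comp (measurable_coulombField d 0)).aestronglyMeasurable
      (ae_of_all _ fun y => ?_)
    simp [hfE, innerSL_apply_norm]
  set L := (ContinuousLinearMap.lsmul ℝ ℝ (E := Eucl d →L[ℝ] ℝ)).flip with hL
  set J : Eucl d → (Eucl d →L[ℝ] ℝ) := convolution fE ρ L volume with hJ
  have hJ1 : ContDiff ℝ 1 J := by
    have := hρc.contDiff_convolution_right (n := 1) L hfEl (by exact_mod_cast hρ)
    exact_mod_cast this
  have hV : coulombPotential ρ = convolution (coulombKernel d 0) ρ
      (ContinuousLinearMap.lsmul ℝ ℝ) volume := by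
    ext x; rw [convolution_lsmul]; rfl
  have hJapply : ∀ x v, J x v = ∫ y, inner ℝ (coulombField d 0 y) v * ρ (x - y) := by
    intro x v
    have hint : Integrable fun t => L (fE t) (ρ (x - t)) :=
      hρc.convolutionExists_right L hfEl hρ.continuous x
    rw [hJ, convolution, ContinuousLinearMap.integral_apply hint]
    refine integral_congr_ae (ae_of_all _ fun y => ?_)
    simp [hL, hfE, mul_comm]
  have hVJ : ∀ x, HasFDerivAt (coulombPotential ρ) (J x) x := by
    intro x
    have h := hρc.hasFDerivAt_convolution_right (ContinuousLinearMap.lsmul ℝ ℝ) hker hρ x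
    rw [← hV] at h
    convert! h using 1
    ext v
    rw [convolution_precompR_apply _ hker (hρc.fderiv ℝ) hDc, hJapply, convolution_lsmul,
      ← integral_coulombKernel_fderiv hd hρ hρc]
    rfl
  have hfd : fderiv ℝ (coulombPotential ρ) = J := funext fun x => (hVJ x).fderiv
  have hCD : ContDiff ℝ 2 (coulombPotential ρ) := by
    have : ContDiff ℝ (1 + 1) (coulombPotential ρ) := by
      rw [contDiff_succ_iff_fderiv]
      exact ⟨fun x => (hVJ x).differentiableAt, by simp, by rw [hfd]; exact hJ1⟩
    exact this
  refine ⟨hCD, fun x => ?_⟩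
  have hDJ : ∀ v w, fderiv ℝ J x v w =
      ∫ y, inner ℝ (coulombField d 0 y) w * fderiv ℝ ρ (x - y) v := by
    intro v w
    have h := hρc.hasFDerivAt_convolution_right L hfEl hρ x
    rw [h.fderiv, convolution_precompR_apply _ hfEl (hρc.fderiv ℝ) hDc]
    have hint : Integrable fun t => L (fE t) (fderiv ℝ ρ (x - t) v) :=
      (((hρc.fderiv ℝ).comp_left (g := fun L : Eucl d →L[ℝ] ℝ => L v) rfl :
        HasCompactSupport fun y => fderiv ℝ ρ y v)).convolutionExists_right L hfEl
        (by fun_prop) x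
    rw [convolution, ContinuousLinearMap.integral_apply hint]
    refine integral_congr_ae (ae_of_all _ fun y => ?_)
    simp [hL, hfE, mul_comm]
  have hlap : Laplacian.laplacian (coulombPotential ρ) x =
      ∑ i, ∫ y, inner ℝ (coulombField d 0 y) (EuclideanSpace.basisFun (Fin d) ℝ i) *
        fderiv ℝ ρ (x - y) (EuclideanSpace.basisFun (Fin d) ℝ i) := by
    rw [InnerProductSpace.laplacian_eq_iteratedFDeriv_orthonormalBasis _
      (EuclideanSpace.basisFun (Fin d) ℝ)]
    refine Finset.sum_congr rfl fun i _ => ?_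
    rw [iteratedFDeriv_two_apply, hfd]
    exact hDJ _ _
  rw [hlap, ← integral_finsetSum]
  · have hφ : ContDiff ℝ 1 fun y => ρ (x - y) := hρ.comp (contDiff_const.sub contDiff_id)
    -- The point-charge identity for `y ↦ ρ (x - y)`, whose value at the origin is `ρ x`; the
    -- reflection produces the minus sign of `-Δ`.
    have key := integral_fderiv_coulombField hd hφ (hρc.comp_const_sub x)
    simp only [fderiv_comp_const_sub hρ, neg_apply, integral_neg,
      sub_zero] at key
    rw [← key]
    congr 1
    refine integral_congr_ae (ae_of_all _ fun y => ?_)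
    simp only
    conv_rhs => rw [← (EuclideanSpace.basisFun (Fin d) ℝ).sum_repr' (coulombField d 0 y)]
    rw [map_sum]
    refine Finset.sum_congr rfl fun i _ => ?_
    rw [map_smul, smul_eq_mul, real_inner_comm]
  · intro i _
    have hm : LocallyIntegrable fun y =>
        inner ℝ (coulombField d 0 y) (EuclideanSpace.basisFun (Fin d) ℝ i) := by
      refine (locallyIntegrable_coulombField hd le_rfl).mono
        ((measurable_coulombField d _).inner_const).aestronglyMeasurable (ae_of_all _ fun y => ?_)
      refine (norm_inner_le_norm _ _).trans ?_
      simp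
    refine integrable_mul_of_locallyIntegrable hm (by fun_prop) ?_
    exact ((hρc.fderiv ℝ).comp_const_sub x).comp_left (g := fun L : Eucl d →L[ℝ] ℝ => L _) rfl

/-! ### Uniqueness for Laplace's equation -/

lemma hasDerivAt_comp_line {d : ℕ} {w : Eucl d → ℝ} (hw : ContDiff ℝ 2 w) (x e : Eucl d) (s : ℝ) :
    HasDerivAt (fun s : ℝ => w (x + s • e)) (fderiv ℝ w (x + s • e) e) s := by
  have h1 : HasDerivAt (fun s : ℝ => x + s • e) e s := by
    simpa using ((hasDerivAt_id s).smul_const e).const_add x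
  exact ((hw.differentiable two_ne_zero).differentiableAt).hasFDerivAt.comp_hasDerivAt s h1

lemma hasDerivAt_fderiv_comp_line {d : ℕ} {w : Eucl d → ℝ} (hw : ContDiff ℝ 2 w) (x e : Eucl d)
    (s : ℝ) : HasDerivAt (fun s : ℝ => fderiv ℝ w (x + s • e) e)
      (fderiv ℝ (fderiv ℝ w) (x + s • e) e e) s := by
  have h1 : HasDerivAt (fun s : ℝ => x + s • e) e s := by
    simpa using ((hasDerivAt_id s).smul_const e).const_add x
  have hd : ContDiff ℝ 1 (fderiv ℝ w) := hw.fderiv_right (by norm_num)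
  exact (((hd.differentiable one_ne_zero).differentiableAt).hasFDerivAt.comp_hasDerivAt s
    h1).clm_apply (hasDerivAt_const s e) |>.congr_deriv (by simp)

lemma laplacian_eq_sum_fderiv {d : ℕ} (w : Eucl d → ℝ) (x : Eucl d) :
    Laplacian.laplacian w x = ∑ i, fderiv ℝ (fderiv ℝ w) x (EuclideanSpace.basisFun (Fin d) ℝ i)
      (EuclideanSpace.basisFun (Fin d) ℝ i) := by
  rw [InnerProductSpace.laplacian_eq_iteratedFDeriv_orthonormalBasis _
    (EuclideanSpace.basisFun (Fin d) ℝ)]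
  exact Finset.sum_congr rfl fun i _ => iteratedFDeriv_two_apply _ _ _

/-- The maximum principle: a harmonic function that vanishes at infinity is nonpositive. -/
lemma nonpos_of_laplacian_eq_zero {d : ℕ} (hd : 1 ≤ d) {w : Eucl d → ℝ} (hw : ContDiff ℝ 2 w)
    (hlap : ∀ x, Laplacian.laplacian w x = 0) (hlim : Tendsto w (cocompact (Eucl d)) (𝓝 0))
    (x₁ : Eucl d) : w x₁ ≤ 0 := by
  by_contra! hη
  set η := w x₁
  have hev : ∀ᶠ x in cocompact (Eucl d), w x < η / 2 := hlim.eventually_lt_const (by linarith)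
  obtain ⟨k, hk, hks⟩ := mem_cocompact.1 hev
  obtain ⟨R, hR⟩ := (hk.union (isCompact_singleton (x := x₁))).isBounded.subset_ball 0
  have hx₁ : ‖x₁‖ < R := by simpa using hR (Or.inr rfl)
  have hR0 : 0 < R := (norm_nonneg _).trans_lt hx₁
  -- The function `w + δ‖·‖²` is strictly subharmonic. With `δ R² = η / 4` its values on the sphere
  -- of radius `R` stay below `η / 2 + η / 4`, whereas it is at least `η` at `x₁`, so its maximum
  -- over the closed ball is interior.
  set δ := η / (4 * R ^ 2) with hδ
  have hδ0 : 0 < δ := by positivity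
  have hδR : δ * R ^ 2 = η / 4 := by rw [hδ]; field_simp
  obtain ⟨z, hz, hmax⟩ := (isCompact_closedBall (0 : Eucl d) R).exists_isMaxOn
    ⟨x₁, by simpa using hx₁.le⟩
    (f := fun x => w x + δ * ‖x‖ ^ 2) (by have := hw.continuous; fun_prop)
  have hz1 : η ≤ w z + δ * ‖z‖ ^ 2 := by
    have : η + δ * ‖x₁‖ ^ 2 ≤ w z + δ * ‖z‖ ^ 2 := hmax (by simpa using hx₁.le)
    have h2 : 0 ≤ δ * ‖x₁‖ ^ 2 := by positivity
    linarith
  have hzR : ‖z‖ ≤ R := by simpa using hz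
  have hzlt : ‖z‖ < R := by
    by_contra! h
    have hzk : w z < η / 2 := by
      refine hks fun hzk => ?_
      have : ‖z‖ < R := by simpa using hR (Or.inl hzk)
      linarith
    have : δ * ‖z‖ ^ 2 ≤ δ * R ^ 2 := by gcongr
    linarith
  have hsum := hlap z
  rw [laplacian_eq_sum_fderiv] at hsum
  -- The diagonal second derivatives sum to zero, so one of them is nonnegative; in that direction
  -- the perturbed function has second derivative at least `2 * δ`.
  obtain ⟨i, hi⟩ : ∃ i : Fin d, 0 ≤ fderiv ℝ (fderiv ℝ w) z (EuclideanSpace.basisFun (Fin d) ℝ i)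
      (EuclideanSpace.basisFun (Fin d) ℝ i) := by
    by_contra! h
    have := Finset.sum_lt_sum_of_nonempty (s := Finset.univ) ⟨⟨0, hd⟩, Finset.mem_univ _⟩
      (fun i _ => h i)
    simp only [Finset.sum_const_zero] at this
    linarith
  set e := EuclideanSpace.basisFun (Fin d) ℝ i
  have he : ‖e‖ = 1 := (EuclideanSpace.basisFun (Fin d) ℝ).orthonormal.1 i
  set φ : ℝ → ℝ := fun s => w (z + s • e) + δ * ‖z + s • e‖ ^ 2 with hφ
  have hq : ∀ s : ℝ, ‖z + s • e‖ ^ 2 = ‖z‖ ^ 2 + 2 * (s * inner ℝ z e) + s ^ 2 := by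
    intro s
    rw [norm_add_sq_real, inner_smul_right, norm_smul, he]
    simp
  have hφ1 : ∀ s, HasDerivAt φ (fderiv ℝ w (z + s • e) e + δ * (2 * inner ℝ z e + 2 * s)) s := by
    intro s
    refine (hasDerivAt_comp_line hw z e s).add (HasDerivAt.const_mul δ ?_)
    simp only [hq]
    have h1 : HasDerivAt (fun s : ℝ => 2 * (s * inner ℝ z e)) (2 * inner ℝ z e) s := by
      simpa using ((hasDerivAt_id s).mul_const (inner ℝ z e)).const_mul 2
    have h2 : HasDerivAt (fun s : ℝ => s ^ 2) (2 * s) s := by simpa using hasDerivAt_pow 2 s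
    exact (h1.const_add (‖z‖ ^ 2)).add h2
  have hφ' : deriv φ = fun s => fderiv ℝ w (z + s • e) e + δ * (2 * inner ℝ z e + 2 * s) :=
    funext fun s => (hφ1 s).deriv
  have hφ2 : deriv (deriv φ) 0 = fderiv ℝ (fderiv ℝ w) z e e + δ * 2 := by
    rw [hφ']
    have h1 := hasDerivAt_fderiv_comp_line hw z e 0
    have h2 : HasDerivAt (fun s : ℝ => 2 * inner ℝ z e + 2 * s) 2 0 := by
      simpa using ((hasDerivAt_id (0 : ℝ)).const_mul 2).const_add (2 * inner ℝ z e)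
    have := (h1.add (h2.const_mul δ)).deriv
    simpa using! this
  have hlmax : IsLocalMax φ 0 := by
    have hcont : Tendsto (fun s : ℝ => z + s • e) (𝓝 0) (𝓝 z) := by
      have : Continuous fun s : ℝ => z + s • e := by fun_prop
      simpa using this.tendsto 0
    have hnear : ∀ᶠ s : ℝ in 𝓝 0, z + s • e ∈ Metric.ball (0 : Eucl d) R :=
      hcont (Metric.isOpen_ball.mem_nhds (by simpa using hzlt))
    filter_upwards [hnear] with s hs
    have := hmax (Metric.ball_subset_closedBall hs)
    simpa [hφ] using this
  have hd0 : deriv φ 0 = 0 := hlmax.deriv_eq_zero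
  -- A critical point with positive second derivative is a local minimum. Being a local maximum too,
  -- it makes `φ` locally constant, contrary to the positive second derivative.
  have hlmin : IsLocalMin φ 0 := isLocalMin_of_deriv_deriv_pos (by rw [hφ2]; linarith) hd0
    (hφ1 0).continuousAt
  have hconst : φ =ᶠ[𝓝 0] fun _ => φ 0 := by
    filter_upwards [hlmax, hlmin] with s h1 h2
    exact le_antisymm h1 h2
  have : deriv (deriv φ) 0 = 0 := by
    rw [hconst.deriv.deriv_eq]; simp
  rw [hφ2] at this
  linarith

lemma eq_zero_of_laplacian_eq_zero {d : ℕ} (hd : 1 ≤ d) {w : Eucl d → ℝ} (hw : ContDiff ℝ 2 w)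
    (hlap : ∀ x, Laplacian.laplacian w x = 0) (hlim : Tendsto w (cocompact (Eucl d)) (𝓝 0)) :
    w = 0 := by
  ext x
  refine le_antisymm (nonpos_of_laplacian_eq_zero hd hw hlap hlim x) ?_
  have := nonpos_of_laplacian_eq_zero hd hw.neg (fun x => by
    change Laplacian.laplacian (-w) x = 0
    rw [InnerProductSpace.laplacian_neg]; simp [hlap]) (by simpa using hlim.neg) x
  simpa using this

/-- On the line, a bounded harmonic function that vanishes at the origin is zero. -/
lemma eq_zero_of_laplacian_eq_zero_of_bounded {w : Eucl 1 → ℝ} (hw : ContDiff ℝ 2 w)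
    (hlap : ∀ x, Laplacian.laplacian w x = 0) (h0 : w 0 = 0) {B : ℝ} (hB : ∀ x, |w x| ≤ B) :
    w = 0 := by
  set e := EuclideanSpace.basisFun (Fin 1) ℝ 0
  have hlap' : ∀ x, fderiv ℝ (fderiv ℝ w) x e e = 0 := fun x => by
    have := hlap x
    rw [laplacian_eq_sum_fderiv] at this
    simpa [e] using this
  have hconst : ∀ s : ℝ, fderiv ℝ w (0 + s • e) e = fderiv ℝ w (0 + (0 : ℝ) • e) e := fun s =>
    is_const_of_deriv_eq_zero (fun s => (hasDerivAt_fderiv_comp_line hw 0 e s).differentiableAt)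
      (fun s => by rw [(hasDerivAt_fderiv_comp_line hw 0 e s).deriv, hlap']) s 0
  set a := fderiv ℝ w (0 + (0 : ℝ) • e) e
  have hlin : ∀ s : ℝ, w (0 + s • e) = a * s := by
    intro s
    have hd : ∀ s, HasDerivAt (fun s : ℝ => w (0 + s • e) - a * s) 0 s := fun s => by
      have h1 := (hasDerivAt_comp_line hw 0 e s).sub ((hasDerivAt_id s).const_mul a)
      rw [hconst s] at h1
      simpa using! h1
    have := is_const_of_deriv_eq_zero (fun s => (hd s).differentiableAt)
      (fun s => (hd s).deriv) s 0
    simp only [zero_add, zero_smul, h0, mul_zero, sub_zero] at this ⊢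
    linarith
  have ha : a = 0 := by
    by_contra ha
    -- At this point the linear function takes the value `B + 1`, beyond its bound.
    have h1 := hB (0 + ((B + 1) / a) • e)
    rw [hlin, mul_div_cancel₀ _ ha] at h1
    have := le_abs_self (B + 1)
    linarith
  ext x
  have hx : x = 0 + (x 0) • e := by
    ext i; fin_cases i; simp [e]
  rw [hx, hlin, ha]; simp

/-! ### Behaviour at infinity; existence and uniqueness of Coulomb potentials -/

lemma abs_coulombPotential_sub_le {d : ℕ} (hd : 1 ≤ d) {ρ : Eucl d → ℝ} (hρ : Continuous ρ)
    (hρc : HasCompactSupport ρ) {R : ℝ} (hR : ∀ y, ρ y ≠ 0 → ‖y‖ ≤ R) {x : Eucl d}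
    (hx : R < ‖x‖) :
    |coulombPotential ρ x - (∫ y, ρ y) * coulombKernel d 0 x| ≤
      coulombConst d * ((‖x‖ - R) ^ (d - 1))⁻¹ * R * ∫ y, |ρ y| := by
  have hi : Integrable fun y => coulombKernel d 0 (x - y) * ρ y := by
    have h1 := integrable_mul_of_locallyIntegrable
      (locallyIntegrable_coulombKernel hd (ε := 0) ⟨le_rfl, zero_le_one⟩)
      (hρ.comp (continuous_sub_left x)) (hρc.comp_const_sub x)
    simpa using h1.comp_sub_left x
  have hρi : Integrable ρ := hρ.integrable_of_hasCompactSupport hρc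
  -- The total mass at the origin is written as the same charges `ρ y`, each moved from `y` to `0`;
  -- every move costs one difference of kernels.
  rw [coulombPotential_eq, ← integral_mul_const, ← integral_sub hi (hρi.mul_const _),
    ← integral_const_mul, ← Real.norm_eq_abs]
  refine norm_integral_le_of_norm_le (hρi.abs.const_mul _) (ae_of_all _ fun y => ?_)
  rw [mul_comm (ρ y), ← sub_mul, norm_mul, Real.norm_eq_abs, Real.norm_eq_abs]
  by_cases hy : ρ y = 0
  · simp [hy]
  · exact mul_le_mul_of_nonneg_right (abs_coulombKernel_sub_le hd le_rfl (hR y hy) hx)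
      (abs_nonneg _)

lemma tendsto_coulombPotential_sub {d : ℕ} (hd : 2 ≤ d) {ρ : Eucl d → ℝ} (hρ : Continuous ρ)
    (hρc : HasCompactSupport ρ) :
    Tendsto (fun x => coulombPotential ρ x - (∫ y, ρ y) * coulombKernel d 0 x)
      (cocompact (Eucl d)) (𝓝 0) := by
  obtain ⟨R, hR⟩ := hρc.isCompact.isBounded.subset_closedBall 0
  have hR' : ∀ y, ρ y ≠ 0 → ‖y‖ ≤ R := fun y hy => by
    simpa using hR (subset_tsupport _ hy)
  have hn : Tendsto (fun x : Eucl d => ‖x‖) (cocompact (Eucl d)) atTop :=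
    tendsto_norm_cocompact_atTop
  have h1 : Tendsto (fun x : Eucl d => ((‖x‖ - R) ^ (d - 1))⁻¹) (cocompact (Eucl d)) (𝓝 0) :=
    tendsto_inv_atTop_zero.comp ((tendsto_pow_atTop (by omega)).comp
      (tendsto_atTop_add_const_right _ (-R) hn))
  have h2 := ((h1.const_mul (coulombConst d)).mul_const R).mul_const (∫ y, |ρ y|)
  simp only [mul_zero, zero_mul] at h2
  refine squeeze_zero_norm' ?_ h2
  filter_upwards [hn.eventually_gt_atTop R] with x hx
  exact abs_coulombPotential_sub_le (by omega) hρ hρc hR' hx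

lemma tendsto_coulombKernel_cocompact {d : ℕ} (hd : 3 ≤ d) :
    Tendsto (coulombKernel d 0) (cocompact (Eucl d)) (𝓝 0) := by
  have hn : Tendsto (fun x : Eucl d => ‖x‖) (cocompact (Eucl d)) atTop :=
    tendsto_norm_cocompact_atTop
  have hd' : (3 : ℝ) ≤ d := by exact_mod_cast hd
  have h1 : Tendsto (fun u : ℝ => u ^ (-((d : ℝ) / 2 - 1))) atTop (𝓝 0) :=
    tendsto_rpow_neg_atTop (by linarith)
  have h2 := (h1.comp ((tendsto_pow_atTop two_ne_zero).comp hn)).const_mul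
    (coulombConst d / (d - 2))
  simp only [mul_zero] at h2
  refine h2.congr fun x => ?_
  simp only [coulombKernel, coulombProfile, show ¬ d = 1 by omega, show ¬ d = 2 by omega,
    if_false, Function.comp, add_zero, neg_sub]

/-- The normalization of the Coulomb potential in dimension one. -/
def coulombOffset {d : ℕ} (ρ : Eucl d → ℝ) : ℝ := if d = 1 then coulombPotential ρ 0 else 0

lemma isCoulombPotential_coulombPotential {d : ℕ} (hd : 1 ≤ d) {F : Phase d → ℝ}
    (hρ : ContDiff ℝ 1 (spatialDensity F)) (hρc : HasCompactSupport (spatialDensity F)) :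
    IsCoulombPotential F
      fun x => coulombPotential (spatialDensity F) x - coulombOffset (spatialDensity F) := by
  obtain ⟨h1, h2⟩ := coulombPotential_contDiff_laplacian hd hρ hρc
  set ρ := spatialDensity F
  refine ⟨h1.sub contDiff_const, fun x => ?_, ?_, ?_, ?_⟩
  · refine Eq.trans ?_ (h2 x)
    have := ContDiffAt.laplacian_sub (h1.contDiffAt (x := x))
      (contDiffAt_const (c := coulombOffset ρ))
    rw [show (fun x => coulombPotential ρ x - coulombOffset ρ) =
      coulombPotential ρ - fun _ => coulombOffset ρ from rfl, this]
    simp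
  · intro h; subst h
    refine ⟨by simp [coulombOffset], ?_⟩
    obtain ⟨R, hR⟩ := hρc.isCompact.isBounded.subset_closedBall 0
    have hR' : ∀ y, ρ y ≠ 0 → ‖y‖ ≤ R := fun y hy => by
      simpa using hR (subset_tsupport _ hy)
    have hk : ∀ x : Eucl 1, coulombKernel 1 0 x = -‖x‖ / 2 := fun x => by
      simp [coulombKernel, coulombProfile, Real.sqrt_sq (norm_nonneg x)]
    have hc : Continuous fun x => coulombPotential ρ x - coulombOffset ρ + (∫ y, ρ y) / 2 * ‖x‖ := by
      have := h1.continuous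
      fun_prop
    obtain ⟨B, hB⟩ := ((isCompact_closedBall (0 : Eucl 1) R).image
      (hc.abs)).isBounded.bddAbove
    -- Inside the ball of radius `R` continuity gives `B`. Outside, the far-field bound does not
    -- decay in dimension one, since its power `d - 1` is zero, but it stays constant, which is all
    -- the normalization asks for.
    refine ⟨max B (coulombConst 1 * R * (∫ y, |ρ y|) + |coulombOffset ρ|), fun x => ?_⟩
    by_cases hx : ‖x‖ ≤ R
    · exact (hB ⟨x, by simpa using hx, rfl⟩).trans (le_max_left _ _)
    · refine le_trans ?_ (le_max_right _ _)
      have h3 := abs_coulombPotential_sub_le hd hρ.continuous hρc hR' (not_le.1 hx)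
      rw [hk] at h3
      simp only [Nat.sub_self, pow_zero, inv_one, mul_one] at h3
      have h4 := abs_sub (coulombPotential ρ x - (∫ y, ρ y) * (-‖x‖ / 2)) (coulombOffset ρ)
      calc _ = |coulombPotential ρ x - (∫ y, ρ y) * (-‖x‖ / 2) - coulombOffset ρ| := by
            congr 1; ring
        _ ≤ _ := by linarith
  · intro h; subst h
    have h3 := tendsto_coulombPotential_sub le_rfl hρ.continuous hρc
    refine h3.congr fun x => ?_
    have hk : coulombKernel 2 0 x = -(Real.log ‖x‖) / (2 * π) := by
      simp only [coulombKernel, coulombProfile]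
      norm_num
      field_simp
      ring
    rw [hk]
    simp [coulombOffset]
    ring
  · intro h
    have h3 := tendsto_coulombPotential_sub (by omega) hρ.continuous hρc
    have h4 := h3.add ((tendsto_coulombKernel_cocompact h).const_mul (∫ y, ρ y))
    simp only [mul_zero, add_zero] at h4
    refine h4.congr fun x => ?_
    simp [coulombOffset, show ¬ d = 1 by omega]

/-- In the difference of two potentials the terms with the total mass cancel. What is left is
harmonic and tends to zero, or, on the line, is bounded and vanishes at the origin. -/
lemma IsCoulombPotential.unique {d : ℕ} (hd : 1 ≤ d) {F : Phase d → ℝ} {V W : Eucl d → ℝ}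
    (hV : IsCoulombPotential F V) (hW : IsCoulombPotential F W) : V = W := by
  have hw : ContDiff ℝ 2 (V - W) := hV.contDiff.sub hW.contDiff
  have hlap : ∀ x, Laplacian.laplacian (V - W) x = 0 := fun x => by
    rw [ContDiffAt.laplacian_sub hV.contDiff.contDiffAt hW.contDiff.contDiffAt]
    have h1 := hV.poisson x
    have h2 := hW.poisson x
    linarith
  suffices V - W = 0 from sub_eq_zero.1 this
  rcases (by omega : d = 1 ∨ d = 2 ∨ 3 ≤ d) with h | h | h
  · subst h
    obtain ⟨hV0, B, hB⟩ := hV.dim_one rfl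
    obtain ⟨hW0, B', hB'⟩ := hW.dim_one rfl
    refine eq_zero_of_laplacian_eq_zero_of_bounded hw hlap (by simp [hV0, hW0]) (B := B + B')
      fun x => ?_
    have h1 := hB x
    have h2 := hB' x
    rw [abs_le] at *
    simp only [Pi.sub_apply]
    constructor <;> linarith
  · refine eq_zero_of_laplacian_eq_zero hd hw hlap ?_
    simpa using ((hV.dim_two h).sub (hW.dim_two h)).congr fun x => by
      simp only [Pi.sub_apply]; ring
  · refine eq_zero_of_laplacian_eq_zero hd hw hlap ?_
    simpa using! (hV.dim_ge_three h).sub (hW.dim_ge_three h)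

/-- The density of a `C¹` function with compact support is `C¹` with compact support. -/
lemma spatialDensity_contDiff {d : ℕ} {F : Phase d → ℝ} (hF : ContDiff ℝ 1 F)
    (hFc : HasCompactSupport F) :
    ContDiff ℝ 1 (spatialDensity F) ∧ HasCompactSupport (spatialDensity F) := by
  constructor
  · have hk : IsCompact (-(Prod.snd '' tsupport F)) :=
      (hFc.isCompact.image continuous_snd).neg
    -- The integral over `p` is the convolution with the constant `1`, evaluated at `0`, of a
    -- function depending on the parameter `x`; the reflection of `p` compensates the one in the
    -- convolution.
    have h := contDiffOn_convolution_right_with_param_comp (n := 1) (μ := (volume : Measure (Eucl d)))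
      (𝕜 := ℝ) (P := Eucl d) (s := univ) (f := fun _ : Eucl d => (1 : ℝ))
      (g := fun x p => F (x, -p)) (v := fun _ => (0 : Eucl d))
      (ContinuousLinearMap.lsmul ℝ ℝ) contDiffOn_const isOpen_univ hk
      (fun x p _ hp => by
        by_contra hne
        exact hp (by simpa using ⟨x, subset_tsupport _ hne⟩))
      (locallyIntegrable_const _) (by
        have : ContDiff ℝ 1 fun z : Eucl d × Eucl d => F (z.1, -z.2) :=
          hF.comp (contDiff_fst.prodMk contDiff_snd.neg)
        exact_mod_cast this.contDiffOn)
    rw [contDiffOn_univ] at h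
    have e : spatialDensity F = fun x => convolution (fun _ : Eucl d => (1 : ℝ))
        (fun p => F (x, -p)) (ContinuousLinearMap.lsmul ℝ ℝ) volume 0 := by
      ext x; simp [convolution_lsmul, spatialDensity]
    rw [e]
    exact_mod_cast h
  · refine HasCompactSupport.intro (hFc.isCompact.image continuous_fst) fun x hx => ?_
    have : ∀ p, F (x, p) = 0 := fun p => by
      by_contra hne
      exact hx ⟨(x, p), subset_tsupport _ hne, rfl⟩
    simp [spatialDensity, this]

lemma existsUnique_isCoulombPotential {d : ℕ} (hd : 1 ≤ d) {F : Phase d → ℝ} (hF : ContDiff ℝ 1 F)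
    (hFc : HasCompactSupport F) : ∃! V : Eucl d → ℝ, IsCoulombPotential F V := by
  obtain ⟨h1, h2⟩ := spatialDensity_contDiff hF hFc
  exact ⟨_, isCoulombPotential_coulombPotential hd h1 h2, fun V hV =>
    hV.unique hd (isCoulombPotential_coulombPotential hd h1 h2)⟩

/-! ### Phase mixing on the covering space -/

/-- Integration by parts along a compactly supported vector field. -/
lemma integral_mul_fderiv_vectorField {d : ℕ} {h φ : Eucl d → ℝ} {w : Eucl d → Eucl d}
    (hh : ContDiff ℝ 1 h) (hφ : ContDiff ℝ 1 φ) (hw : ContDiff ℝ 1 w) (hwc : HasCompactSupport w) :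
    ∫ k, h k * fderiv ℝ φ k (w k) =
      -∫ k, φ k * ∑ j, fderiv ℝ (fun k => h k * w k j) k (EuclideanSpace.basisFun (Fin d) ℝ j) := by
  set e := EuclideanSpace.basisFun (Fin d) ℝ with he
  have hu : ∀ j, ContDiff ℝ 1 fun k => h k * w k j := fun j =>
    hh.mul ((EuclideanSpace.proj (𝕜 := ℝ) j).contDiff.comp hw)
  have huc : ∀ j, HasCompactSupport fun k => h k * w k j := fun j =>
    (hwc.comp_left (g := fun v : Eucl d => v j) rfl).mul_left
  have hφD : Continuous (fderiv ℝ φ) := hφ.continuous_fderiv one_ne_zero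
  have huD : ∀ j, Continuous (fderiv ℝ fun k => h k * w k j) := fun j =>
    (hu j).continuous_fderiv one_ne_zero
  have i1 : ∀ j, Integrable fun k => h k * w k j * fderiv ℝ φ k (e j) := fun j =>
    Continuous.integrable_of_hasCompactSupport
      ((hu j).continuous.mul (hφD.clm_apply continuous_const)) (huc j).mul_right
  have i2 : ∀ j, Integrable fun k => fderiv ℝ (fun k => h k * w k j) k (e j) * φ k := fun j =>
    Continuous.integrable_of_hasCompactSupport
      (((huD j).clm_apply continuous_const).mul hφ.continuous)
      (((huc j).fderiv ℝ).comp_left (g := fun L : Eucl d →L[ℝ] ℝ => L (e j)) rfl).mul_right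
  have i3 : ∀ j, Integrable fun k => h k * w k j * φ k := fun j =>
    Continuous.integrable_of_hasCompactSupport ((hu j).continuous.mul hφ.continuous)
      (huc j).mul_right
  have hpt : ∀ k, h k * fderiv ℝ φ k (w k) = ∑ j, h k * w k j * fderiv ℝ φ k (e j) := by
    intro k
    conv_lhs => rw [← e.sum_repr (w k), map_sum, Finset.mul_sum]
    refine Finset.sum_congr rfl fun j _ => ?_
    rw [map_smul, smul_eq_mul, mul_assoc]
    simp [he]
  simp only [hpt, Finset.mul_sum]
  rw [integral_finsetSum _ fun j _ => i1 j,
    integral_finsetSum _ fun j _ => by simpa only [mul_comm] using i2 j, ← Finset.sum_neg_distrib]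
  refine Finset.sum_congr rfl fun j _ => ?_
  rw [integral_mul_fderiv_eq_neg_fderiv_mul_of_integrable (i2 j) (i1 j) (i3 j)
    (fun k _ => ((hu j).differentiable one_ne_zero).differentiableAt)
    (fun k _ => (hφ.differentiable one_ne_zero).differentiableAt)]
  simp only [mul_comm]

/-- This controls the divergence of `h w`, to which integration by parts transfers the derivative:
the product rule costs `a` in each of the `d` coordinates. -/
lemma abs_sum_fderiv_mul_le {d : ℕ} {h : Eucl d → ℝ} {w : Eucl d → Eucl d} (hh : ContDiff ℝ 1 h)
    (hw : ContDiff ℝ 1 w) {a : ℝ} (hwa : ∀ k, ‖w k‖ ≤ a) (hwa' : ∀ k, ‖fderiv ℝ w k‖ ≤ a)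
    (k : Eucl d) :
    |∑ j, fderiv ℝ (fun k => h k * w k j) k (EuclideanSpace.basisFun (Fin d) ℝ j)| ≤
      d * a * (|h k| + ‖fderiv ℝ h k‖) := by
  have h1 : ∀ j, |fderiv ℝ (fun k => h k * w k j) k (EuclideanSpace.basisFun (Fin d) ℝ j)| ≤
      a * (|h k| + ‖fderiv ℝ h k‖) := by
    intro j
    have hd1 := ((hh.differentiable one_ne_zero).differentiableAt (x := k)).hasFDerivAt
    have hd2 := (EuclideanSpace.proj (𝕜 := ℝ) j).hasFDerivAt.comp k
      ((hw.differentiable one_ne_zero).differentiableAt (x := k)).hasFDerivAt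
    have hd3 := hd1.mul hd2
    have he : ‖EuclideanSpace.basisFun (Fin d) ℝ j‖ = 1 :=
      (EuclideanSpace.basisFun (Fin d) ℝ).orthonormal.1 j
    have hd4 : fderiv ℝ (fun k => h k * w k j) k (EuclideanSpace.basisFun (Fin d) ℝ j) =
        h k * (fderiv ℝ w k (EuclideanSpace.basisFun (Fin d) ℝ j)) j +
          w k j * fderiv ℝ h k (EuclideanSpace.basisFun (Fin d) ℝ j) := by
      rw [show (fun k => h k * w k j) = h * (⇑(EuclideanSpace.proj (𝕜 := ℝ) j) ∘ w) from rfl,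
        hd3.fderiv]
      simp
    rw [hd4]
    refine (abs_add_le _ _).trans ?_
    rw [abs_mul, abs_mul]
    have b1 : |(fderiv ℝ w k (EuclideanSpace.basisFun (Fin d) ℝ j)) j| ≤ a := by
      refine (PiLp.norm_apply_le _ j).trans (((fderiv ℝ w k).le_opNorm _).trans ?_)
      rw [he, mul_one]; exact hwa' k
    have b2 : |w k j| ≤ a := (PiLp.norm_apply_le _ j).trans (hwa k)
    have b3 : |fderiv ℝ h k (EuclideanSpace.basisFun (Fin d) ℝ j)| ≤ ‖fderiv ℝ h k‖ := by
      refine ((fderiv ℝ h k).le_opNorm _).trans ?_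
      rw [he, mul_one]
    have c1 := mul_le_mul_of_nonneg_left b1 (abs_nonneg (h k))
    have c2 := mul_le_mul b2 b3 (abs_nonneg _) ((abs_nonneg _).trans b2)
    linarith
  refine (Finset.abs_sum_le_sum_abs _ _).trans ((Finset.sum_le_sum fun j _ => h1 j).trans ?_)
  simp [mul_assoc]

/-- Phase mixing for fixed angles: the oscillation of a shifted density in the angles is turned
into a derivative in the actions, at the gain of a factor `1 / t`. -/
lemma abs_integral_mul_fderiv_shift_le {d : ℕ} {f : Eucl d × Eucl d → ℝ} {h : Eucl d → ℝ}
    {Ω w : Eucl d → Eucl d} {Kc K₁ : Set (Eucl d)} (hf : ContDiff ℝ 1 f) (hh : ContDiff ℝ 1 h)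
    (hΩ : ContDiff ℝ 1 Ω) (hw : ContDiff ℝ 1 w) (hKc : IsCompact Kc) (hK₁ : IsCompact K₁)
    (hKcK₁ : Kc ⊆ K₁) (hwK₁ : ∀ k ∉ K₁, w k = 0) (hfK : ∀ y, ∀ k ∉ Kc, f (y, k) = 0)
    {e : Eucl d} (hwe : ∀ k ∈ Kc, fderiv ℝ Ω k (w k) = e) {A a : ℝ}
    (hfA : ∀ z, |f z| ≤ A) (hfA' : ∀ z, ‖fderiv ℝ f z‖ ≤ A)
    (hwa : ∀ k, ‖w k‖ ≤ a) (hwa' : ∀ k, ‖fderiv ℝ w k‖ ≤ a) (he : ‖e‖ ≤ a) (q : Eucl d) (t : ℝ) :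
    (1 + |t|) * |∫ k, h k * fderiv ℝ f (q - t • Ω k, k) (e, 0)| ≤
      (d + 2) * A * a * ∫ k in K₁, (|h k| + ‖fderiv ℝ h k‖) := by
  have hA : 0 ≤ A := (abs_nonneg _).trans (hfA 0)
  have ha : 0 ≤ a := (norm_nonneg _).trans he
  have hDf : Continuous (fderiv ℝ f) := hf.continuous_fderiv one_ne_zero
  have hDh : Continuous (fderiv ℝ h) := hh.continuous_fderiv one_ne_zero
  have hΩc := hΩ.continuous
  have hfK' : ∀ y, ∀ k ∉ Kc, fderiv ℝ f (y, k) = 0 := by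
    intro y k hk
    have : f =ᶠ[𝓝 (y, k)] fun _ => 0 := by
      have ho : IsOpen (univ ×ˢ Kcᶜ : Set (Eucl d × Eucl d)) :=
        isOpen_univ.prod hKc.isClosed.isOpen_compl
      filter_upwards [ho.mem_nhds ⟨mem_univ _, hk⟩] with z hz
      exact hfK z.1 z.2 hz.2
    rw [this.fderiv_eq]; simp
  have hwc : HasCompactSupport w := HasCompactSupport.intro hK₁ hwK₁
  set y : Eucl d → Eucl d × Eucl d := fun k => (q - t • Ω k, k) with hy
  have hyC : ContDiff ℝ 1 y := (contDiff_const.sub (hΩ.const_smul t)).prodMk contDiff_id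
  set φ : Eucl d → ℝ := fun k => f (y k) with hφ
  have hφC : ContDiff ℝ 1 φ := hf.comp hyC
  -- Along `w` the frequency `Ω` moves in the direction `e`, so the phase moves by `-t • e`. Outside
  -- `Kc` the relation between `w` and `e` may fail, but there the derivative of `f` vanishes.
  have hφd : ∀ k, fderiv ℝ φ k (w k) =
      -t * fderiv ℝ f (y k) (e, 0) + fderiv ℝ f (y k) (0, w k) := by
    intro k
    have h1 : HasFDerivAt y ((-(t • fderiv ℝ Ω k)).prod (ContinuousLinearMap.id ℝ _)) k :=
      HasFDerivAt.prodMk ((((hΩ.differentiable one_ne_zero).differentiableAt).hasFDerivAt.const_smul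
        t).const_sub q) (hasFDerivAt_id k)
    have h2 := ((hf.differentiable one_ne_zero).differentiableAt (x := y k)).hasFDerivAt.comp k h1
    rw [show φ = f ∘ y from rfl, h2.fderiv]
    by_cases hk : k ∈ Kc
    · have h3 : ((-(t • fderiv ℝ Ω k)).prod (ContinuousLinearMap.id ℝ _)) (w k) =
          (-t) • (e, (0 : Eucl d)) + (0, w k) := by
        simp [hwe k hk]
      rw [ContinuousLinearMap.comp_apply, h3, map_add, map_smul, smul_eq_mul]
    · simp [hy, hfK' _ k hk]
  set S := ∫ k in K₁, (|h k| + ‖fderiv ℝ h k‖) with hS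
  have hbc : Continuous fun k => |h k| + ‖fderiv ℝ h k‖ := by
    have := hh.continuous; fun_prop
  have hSi : IntegrableOn (fun k => |h k| + ‖fderiv ℝ h k‖) K₁ :=
    hbc.continuousOn.integrableOn_compact hK₁
  have bound : ∀ (u : Eucl d → ℝ) (c : ℝ), (∀ k ∉ K₁, u k = 0) →
      (∀ k, |u k| ≤ c * (|h k| + ‖fderiv ℝ h k‖)) → |∫ k, u k| ≤ c * S := by
    intro u c hu0 hu
    rw [← setIntegral_eq_integral_of_forall_compl_eq_zero (s := K₁) hu0, hS, ← integral_const_mul,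
      ← Real.norm_eq_abs]
    exact norm_integral_le_of_norm_le (f := u) (hSi.const_mul c) (ae_of_all _ fun k => hu k)
  have cont1 : Continuous fun k => h k * fderiv ℝ f (y k) (e, 0) :=
    hh.continuous.mul ((hDf.comp hyC.continuous).clm_apply continuous_const)
  have zero1 : ∀ k ∉ K₁, h k * fderiv ℝ f (y k) (e, 0) = 0 := fun k hk => by
    rw [hy, hfK' _ k fun h => hk (hKcK₁ h)]; simp
  have int1 : Integrable fun k => h k * fderiv ℝ f (y k) (e, 0) :=
    cont1.integrable_of_hasCompactSupport (HasCompactSupport.intro hK₁ zero1)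
  have cont2 : Continuous fun k => h k * fderiv ℝ f (y k) (0, w k) :=
    hh.continuous.mul ((hDf.comp hyC.continuous).clm_apply (continuous_const.prodMk hw.continuous))
  have zero2 : ∀ k ∉ K₁, h k * fderiv ℝ f (y k) (0, w k) = 0 := fun k hk => by
    rw [hy, hfK' _ k fun h => hk (hKcK₁ h)]; simp
  have int2 : Integrable fun k => h k * fderiv ℝ f (y k) (0, w k) :=
    cont2.integrable_of_hasCompactSupport (HasCompactSupport.intro hK₁ zero2)
  have b1 : |∫ k, h k * fderiv ℝ f (y k) (e, 0)| ≤ (A * a) * S := by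
    refine bound _ _ zero1 fun k => ?_
    rw [abs_mul]
    have h1 : |fderiv ℝ f (y k) (e, 0)| ≤ A * a := by
      refine ((fderiv ℝ f (y k)).le_opNorm _).trans
        (mul_le_mul (hfA' _) ?_ (norm_nonneg _) hA)
      simpa [Prod.norm_def] using he
    calc |h k| * |fderiv ℝ f (y k) (e, 0)| ≤ |h k| * (A * a) := by gcongr
      _ ≤ _ := by
        have := mul_nonneg (mul_nonneg hA ha) (norm_nonneg (fderiv ℝ h k))
        linarith
  have b2 : |∫ k, h k * fderiv ℝ f (y k) (0, w k)| ≤ (A * a) * S := by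
    refine bound _ _ zero2 fun k => ?_
    rw [abs_mul]
    have h1 : |fderiv ℝ f (y k) (0, w k)| ≤ A * a := by
      refine ((fderiv ℝ f (y k)).le_opNorm _).trans
        (mul_le_mul (hfA' _) ?_ (norm_nonneg _) hA)
      simpa [Prod.norm_def] using hwa k
    calc |h k| * |fderiv ℝ f (y k) (0, w k)| ≤ |h k| * (A * a) := by gcongr
      _ ≤ _ := by
        have := mul_nonneg (mul_nonneg hA ha) (norm_nonneg (fderiv ℝ h k))
        linarith
  -- This term contains a derivative of `φ`, which grows with `t`. By parts only `φ` itself remains,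
  -- and the bound is free of `t`.
  have b3 : |∫ k, h k * fderiv ℝ φ k (w k)| ≤ (A * (d * a)) * S := by
    rw [integral_mul_fderiv_vectorField hh hφC hw hwc, abs_neg]
    refine bound _ _ (fun k hk => ?_) fun k => ?_
    · rw [hφ]
      simp only [hy]
      rw [hfK _ k fun h => hk (hKcK₁ h), zero_mul]
    · rw [abs_mul, mul_assoc]
      exact mul_le_mul (hfA _) (abs_sum_fderiv_mul_le hh hw hwa hwa' k) (abs_nonneg _) hA
  have id1 : ∫ k, h k * fderiv ℝ φ k (w k) = -t * (∫ k, h k * fderiv ℝ f (y k) (e, 0)) +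
      ∫ k, h k * fderiv ℝ f (y k) (0, w k) := by
    rw [← integral_const_mul, ← integral_add (int1.const_mul _) int2]
    refine integral_congr_ae (ae_of_all _ fun k => ?_)
    simp only [hφd]; ring
  have b4 : |t| * |∫ k, h k * fderiv ℝ f (y k) (e, 0)| ≤ (A * a) * S + (A * (d * a)) * S := by
    rw [← abs_mul]
    have : t * (∫ k, h k * fderiv ℝ f (y k) (e, 0)) =
        (∫ k, h k * fderiv ℝ f (y k) (0, w k)) - ∫ k, h k * fderiv ℝ φ k (w k) := by
      rw [id1]; ring
    rw [this]
    exact (abs_sub _ _).trans (add_le_add b2 b3)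
  -- The summand `1` of `1 + |t|` contributes one multiple of `A * a * S` through `b1`, the summand
  -- `|t|` contributes `d + 1` of them through `b4`.
  linarith

lemma Continuous.integrableOn_strip {d : ℕ} {g : Eucl d × Eucl d → ℝ} (hg : Continuous g)
    {Q K₁ : Set (Eucl d)} (hQ : MeasurableSet Q) (hQb : Bornology.IsBounded Q)
    (hK₁ : IsCompact K₁) (hz : ∀ z : Eucl d × Eucl d, z.2 ∉ K₁ → g z = 0) :
    IntegrableOn g (Q ×ˢ (univ : Set (Eucl d))) := by
  have h1 : IntegrableOn g (Q ×ˢ K₁) :=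
    (hg.continuousOn.integrableOn_compact (hQb.prod hK₁.isBounded).isCompact_closure).mono_set
      subset_closure
  rw [← integrable_indicator_iff (hQ.prod hK₁.measurableSet)] at h1
  rw [← integrable_indicator_iff (hQ.prod MeasurableSet.univ)]
  refine h1.congr (ae_of_all _ fun z => ?_)
  by_cases hk : z.2 ∈ K₁
  · by_cases hq : z.1 ∈ Q
    · rw [indicator_of_mem (show z ∈ Q ×ˢ K₁ from ⟨hq, hk⟩),
        indicator_of_mem (show z ∈ Q ×ˢ univ from ⟨hq, mem_univ _⟩)]
    · rw [indicator_of_notMem fun h => hq h.1, indicator_of_notMem fun h => hq h.1]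
  · rw [indicator_apply_eq_zero.2 fun _ => hz z hk, indicator_apply_eq_zero.2 fun _ => hz z hk]

/-- Phase mixing: shifting the angles changes the integral against `h` by at most `O(1 / t)`. -/
lemma abs_integral_shift_sub_le {d : ℕ} {f h : Eucl d × Eucl d → ℝ}
    {Ω : Eucl d → Eucl d} {w : Eucl d → Eucl d} {Q Kc K₁ : Set (Eucl d)} (hf : ContDiff ℝ 1 f)
    (hh : ContDiff ℝ 1 h) (hΩ : ContDiff ℝ 1 Ω) (hw : ContDiff ℝ 1 w) (hQ : MeasurableSet Q)
    (hQb : Bornology.IsBounded Q) (hKc : IsCompact Kc) (hK₁ : IsCompact K₁)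
    (hKcK₁ : Kc ⊆ K₁) (hwK₁ : ∀ k ∉ K₁, w k = 0) (hfK : ∀ y, ∀ k ∉ Kc, f (y, k) = 0)
    {e : Eucl d} (hwe : ∀ k ∈ Kc, fderiv ℝ Ω k (w k) = e) {A a : ℝ}
    (hfA : ∀ z, |f z| ≤ A) (hfA' : ∀ z, ‖fderiv ℝ f z‖ ≤ A)
    (hwa : ∀ k, ‖w k‖ ≤ a) (hwa' : ∀ k, ‖fderiv ℝ w k‖ ≤ a) (he : ‖e‖ ≤ a) (t : ℝ) :
    (1 + |t|) * |(∫ z in Q ×ˢ univ, h z * f (z.1 + e - t • Ω z.2, z.2)) -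
        ∫ z in Q ×ˢ univ, h z * f (z.1 - t • Ω z.2, z.2)| ≤
      (d + 2) * A * a * ∫ z in Q ×ˢ K₁, (|h z| + ‖fderiv ℝ h z‖) := by
  have hA : 0 ≤ A := (abs_nonneg _).trans (hfA 0)
  have ha : 0 ≤ a := (norm_nonneg _).trans he
  have hDf : Continuous (fderiv ℝ f) := hf.continuous_fderiv one_ne_zero
  have hDh : Continuous (fderiv ℝ h) := hh.continuous_fderiv one_ne_zero
  have hΩc := hΩ.continuous
  have hhc := hh.continuous
  have hfc := hf.continuous
  have hfK' : ∀ y, ∀ k ∉ Kc, fderiv ℝ f (y, k) = 0 := by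
    intro y k hk
    have : f =ᶠ[𝓝 (y, k)] fun _ => 0 := by
      have ho : IsOpen (univ ×ˢ Kcᶜ : Set (Eucl d × Eucl d)) :=
        isOpen_univ.prod hKc.isClosed.isOpen_compl
      filter_upwards [ho.mem_nhds ⟨mem_univ _, hk⟩] with z hz
      exact hfK z.1 z.2 hz.2
    rw [this.fderiv_eq]; simp
  have hQK : Bornology.IsBounded (Q ×ˢ K₁) := hQb.prod hK₁.isBounded
  have hQKc : IsCompact (closure (Q ×ˢ K₁)) := hQK.isCompact_closure
  have hQKm : MeasurableSet (Q ×ˢ K₁) := hQ.prod hK₁.measurableSet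
  have hQu : MeasurableSet (Q ×ˢ (univ : Set (Eucl d))) := hQ.prod MeasurableSet.univ
  obtain ⟨B, hB⟩ := (hQKc.image hhc.abs).isBounded.bddAbove
  have hB' : ∀ z ∈ Q ×ˢ K₁, |h z| ≤ B := fun z hz => hB ⟨z, subset_closure hz, rfl⟩
  -- The parameter `s` interpolates between the unshifted density at `s = 0` and the one shifted by
  -- `e` at `s = 1`. The mean value inequality reduces the claim to a bound on the `s`-derivative.
  set y : ℝ → Eucl d × Eucl d → Eucl d × Eucl d := fun s z => (z.1 + s • e - t • Ω z.2, z.2) with hy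
  have hyc : ∀ s, Continuous (y s) := fun s => by simp only [hy]; fun_prop
  set D : ℝ → Eucl d × Eucl d → ℝ := fun s z => h z * fderiv ℝ f (y s z) (e, 0) with hD
  have hDc : ∀ s, Continuous (D s) := fun s =>
    hhc.mul ((hDf.comp (hyc s)).clm_apply continuous_const)
  have hD0 : ∀ s z, z.2 ∉ K₁ → D s z = 0 := fun s z hz => by
    simp only [hD, hy]; rw [hfK' _ _ fun hk => hz (hKcK₁ hk)]; simp
  have hbi : Integrable ((Q ×ˢ K₁).indicator fun _ => B * (A * a))
      (volume.restrict (Q ×ˢ (univ : Set (Eucl d)))) := by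
    refine Integrable.restrict ?_
    rw [integrable_indicator_iff hQKm]
    exact integrableOn_const hQK.measure_lt_top.ne
  have hDb : ∀ s, ∀ z ∈ Q ×ˢ (univ : Set (Eucl d)),
      ‖D s z‖ ≤ (Q ×ˢ K₁).indicator (fun _ => B * (A * a)) z := by
    intro s z hz
    by_cases hk : z.2 ∈ K₁
    · rw [indicator_of_mem (show z ∈ Q ×ˢ K₁ from ⟨hz.1, hk⟩), hD, norm_mul]
      refine mul_le_mul (hB' z ⟨hz.1, hk⟩) ?_ (norm_nonneg _)
        ((abs_nonneg _).trans (hB' z ⟨hz.1, hk⟩))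
      refine ((fderiv ℝ f _).le_opNorm _).trans (mul_le_mul (hfA' _) ?_ (norm_nonneg _) hA)
      simpa [Prod.norm_def] using he
    · rw [hD0 s z hk, norm_zero, indicator_of_notMem fun h => hk h.2]
  have hDi : ∀ s, IntegrableOn (D s) (Q ×ˢ (univ : Set (Eucl d))) := fun s =>
    hbi.mono' (hDc s).aestronglyMeasurable ((ae_restrict_iff' hQu).2 (ae_of_all _ (hDb s)))
  set J : ℝ → ℝ := fun s => ∫ z in Q ×ˢ univ, h z * f (y s z) with hJ
  have hgc : ∀ s, Continuous fun z => h z * f (y s z) := fun s => hhc.mul (hfc.comp (hyc s))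
  have hgi : ∀ s, IntegrableOn (fun z => h z * f (y s z)) (Q ×ˢ (univ : Set (Eucl d))) :=
    fun s => (hgc s).integrableOn_strip hQ hQb hK₁ fun z hz => by
      rw [show f (y s z) = 0 from hfK _ _ fun h => hz (hKcK₁ h), mul_zero]
  have hpt : ∀ z s, HasDerivAt (fun s => h z * f (y s z)) (D s z) s := by
    intro z s
    have h1 : HasDerivAt (fun s => y s z) (e, (0 : Eucl d)) s := by
      refine HasDerivAt.prodMk ?_ (hasDerivAt_const s z.2)
      have h2 : HasDerivAt (fun s : ℝ => s • e) e s := by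
        simpa using (hasDerivAt_id s).smul_const e
      exact (h2.const_add z.1).sub_const _
    exact (((hf.differentiable one_ne_zero).differentiableAt).hasFDerivAt.comp_hasDerivAt s
      h1).const_mul (h z)
  have hJd : ∀ s, HasDerivAt J (∫ z in Q ×ˢ univ, D s z) s := by
    intro s
    refine (hasDerivAt_integral_of_dominated_loc_of_deriv_le (s := univ) univ_mem
      (Eventually.of_forall fun s => (hgc s).aestronglyMeasurable) (hgi s)
      (hDc s).aestronglyMeasurable ?_ hbi (ae_of_all _ fun z s _ => hpt z s)).2
    exact (ae_restrict_iff' hQu).2 (ae_of_all _ fun z hz s _ => hDb s z hz)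
  set S := ∫ z in Q ×ˢ K₁, (|h z| + ‖fderiv ℝ h z‖) with hS
  have hSc : Continuous fun z => |h z| + ‖fderiv ℝ h z‖ := by fun_prop
  have hSi : IntegrableOn (fun z => |h z| + ‖fderiv ℝ h z‖) (Q ×ˢ K₁) :=
    (hSc.continuousOn.integrableOn_compact hQKc).mono_set subset_closure
  have ht : 0 < 1 + |t| := by positivity
  -- By Fubini this is the estimate at fixed angles, with base point `q + s • e`, integrated over
  -- `q`; the derivative of `h` in the actions alone is dominated by its full derivative.
  have hDbound : ∀ s, ‖∫ z in Q ×ˢ univ, D s z‖ ≤ ((d + 2) * A * a * S) / (1 + |t|) := by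
    intro s
    rw [le_div_iff₀' ht, hS, Measure.volume_eq_prod]
    have hi1 := hDi s
    have hi2 := hSi
    rw [Measure.volume_eq_prod] at hi1 hi2
    rw [setIntegral_prod _ hi1, setIntegral_prod _ hi2, ← integral_const_mul,
      ← abs_of_pos ht, ← Real.norm_eq_abs (1 + |t|), ← norm_mul, ← integral_const_mul]
    have hi3 : IntegrableOn (fun q => ∫ k in K₁, (|h (q, k)| + ‖fderiv ℝ h (q, k)‖)) Q := by
      rw [IntegrableOn, ← Measure.prod_restrict] at hi2
      exact hi2.integral_prod_left
    refine norm_integral_le_of_norm_le (hi3.const_mul _) (ae_of_all _ fun q => ?_)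
    simp only [Measure.restrict_univ]
    have hhq : ContDiff ℝ 1 fun k => h (q, k) := hh.comp (contDiff_prodMk_right q)
    have key := abs_integral_mul_fderiv_shift_le (h := fun k => h (q, k)) hf hhq hΩ hw hKc hK₁ hKcK₁
      hwK₁ hfK hwe hfA hfA' hwa hwa' he (q + s • e) t
    rw [norm_mul, Real.norm_of_nonneg ht.le]
    refine key.trans (mul_le_mul_of_nonneg_left ?_ (by positivity))
    refine setIntegral_mono ?_ ?_ fun k => ?_
    · have hD1 : Continuous (fderiv ℝ fun k => h (q, k)) := hhq.continuous_fderiv one_ne_zero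
      exact (by fun_prop : Continuous fun k => |h (q, k)| +
        ‖fderiv ℝ (fun k => h (q, k)) k‖).continuousOn.integrableOn_compact hK₁
    · exact (by fun_prop : Continuous fun k => |h (q, k)| +
        ‖fderiv ℝ h (q, k)‖).continuousOn.integrableOn_compact hK₁
    · simp only [add_le_add_iff_left]
      have h1 := ((hh.differentiable one_ne_zero).differentiableAt
        (x := (q, k))).hasFDerivAt.comp k (hasFDerivAt_prodMk_right q k)
      have h2 : fderiv ℝ (fun k => h (q, k)) k =
          (fderiv ℝ h (q, k)).comp (ContinuousLinearMap.inr ℝ (Eucl d) (Eucl d)) := h1.fderiv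
      rw [h2]
      refine (ContinuousLinearMap.opNorm_comp_le _ _).trans ?_
      exact mul_le_of_le_one_right (norm_nonneg _) (ContinuousLinearMap.norm_inr_le_one ℝ _ _)
  have hmv := (convex_univ (𝕜 := ℝ) (E := ℝ)).norm_image_sub_le_of_norm_hasDerivWithin_le
    (f := J) (fun s _ => (hJd s).hasDerivWithinAt) (fun s _ => hDbound s) (mem_univ 0) (mem_univ 1)
  simp only [hJ, hy, sub_zero, norm_one, mul_one, one_smul, zero_smul, add_zero] at hmv
  rwa [le_div_iff₀' ht] at hmv

/-! ### The torus: period cell and averages over the angles -/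

lemma continuous_torusProj (d : ℕ) : Continuous (torusProj d) := by
  unfold torusProj
  refine continuous_pi fun i => ?_
  exact (AddCircle.continuous_mk' (2 * π)).comp (EuclideanSpace.proj (𝕜 := ℝ) i).continuous

lemma torusProj_add {d : ℕ} (x y : Eucl d) :
    torusProj d (x + y) = torusProj d x + torusProj d y := by
  ext i; simp [torusProj]

/-- The fundamental domain of the torus. -/
def torusBox (d : ℕ) : Set (Eucl d) := {q | ∀ i, q i ∈ Ioc 0 (0 + 2 * π)}

lemma torusBox_eq (d : ℕ) :
    torusBox d = WithLp.ofLp ⁻¹' (univ.pi fun _ : Fin d => Ioc 0 (0 + 2 * π)) := by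
  ext q; simp [torusBox]

lemma measurableSet_torusBox (d : ℕ) : MeasurableSet (torusBox d) := by
  rw [torusBox_eq]
  exact (MeasurableSet.univ_pi fun _ => measurableSet_Ioc).preimage
    (PiLp.volume_preserving_ofLp (Fin d)).measurable

lemma norm_le_of_mem_torusBox {d : ℕ} {q : Eucl d} (hq : q ∈ torusBox d) :
    ‖q‖ ≤ √(d * (2 * π) ^ 2) := by
  rw [EuclideanSpace.norm_eq]
  refine Real.sqrt_le_sqrt ?_
  calc ∑ i, ‖q i‖ ^ 2 ≤ ∑ _i : Fin d, (2 * π) ^ 2 := by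
        refine Finset.sum_le_sum fun i _ => ?_
        have := hq i
        rw [Real.norm_of_nonneg this.1.le]
        have h2 := this.2
        rw [zero_add] at h2
        exact pow_le_pow_left₀ this.1.le h2 2
    _ = _ := by simp

lemma isBounded_torusBox (d : ℕ) : Bornology.IsBounded (torusBox d) :=
  isBounded_iff_forall_norm_le.2 ⟨_, fun _ hq => norm_le_of_mem_torusBox hq⟩

lemma exists_mem_torusBox {d : ℕ} (τ : Torus d) : ∃ q ∈ torusBox d, torusProj d q = τ := by
  refine ⟨WithLp.toLp 2 fun i => (AddCircle.equivIoc (2 * π) 0 (τ i) : ℝ), fun i => ?_, ?_⟩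
  · exact (AddCircle.equivIoc (2 * π) 0 (τ i)).2
  · ext i
    exact (AddCircle.equivIoc (2 * π) 0).symm_apply_apply (τ i)

lemma injOn_torusProj (d : ℕ) : InjOn (torusProj d) (torusBox d) := by
  intro x hx y hy h
  ext i
  have hi : (x i : AddCircle (2 * π)) = y i := congrFun h i
  exact AddCircle.coe_eq_coe_iff_of_mem_Ioc (hx i) (hy i) |>.1 hi

lemma measurePreserving_torusProj (d : ℕ) :
    MeasurePreserving (torusProj d) (volume.restrict (torusBox d)) volume := by
  have h1 : MeasurePreserving (WithLp.ofLp : Eucl d → (Fin d → ℝ)) (volume.restrict (torusBox d))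
      (volume.restrict (univ.pi fun _ : Fin d => Ioc 0 (0 + 2 * π))) := by
    rw [torusBox_eq]
    exact (PiLp.volume_preserving_ofLp (Fin d)).restrict_preimage
      (MeasurableSet.univ_pi fun _ => measurableSet_Ioc)
  have h2 : MeasurePreserving (fun (q : Fin d → ℝ) i => (q i : AddCircle (2 * π)))
      (volume.restrict (univ.pi fun _ : Fin d => Ioc 0 (0 + 2 * π))) volume := by
    rw [volume_pi, Measure.restrict_pi_pi]
    exact measurePreserving_pi _ _ fun i => AddCircle.measurePreserving_mk (2 * π) 0
  exact h2.comp h1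

lemma setIntegral_torusBox {d : ℕ} {g : Torus d → ℝ} (hg : Continuous g) :
    ∫ q in torusBox d, g (torusProj d q) = ∫ τ, g τ := by
  rw [← (measurePreserving_torusProj d).map_eq, integral_map
    (continuous_torusProj d).aemeasurable hg.aestronglyMeasurable]

lemma volume_real_univ_torus (d : ℕ) : volume.real (univ : Set (Torus d)) = (2 * π) ^ d := by
  rw [Measure.real, volume_pi, Measure.pi_univ]
  simp [AddCircle.measure_univ]
  simp [Real.pi_pos.le]

lemma volume_real_torusBox (d : ℕ) : volume.real (torusBox d) = (2 * π) ^ d := by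
  have := setIntegral_torusBox (d := d) (g := fun _ => 1) continuous_const
  simpa [volume_real_univ_torus] using this

lemma integral_torus_translate {d : ℕ} {fT : Torus d × Eucl d → ℝ} (a : Torus d) (k : Eucl d) :
    ∫ τ, fT (a + τ, k) = (2 * π) ^ d * angleAverage fT k := by
  have h : ((2 : ℝ) * π) ^ d ≠ 0 := by positivity
  rw [angleAverage, mul_inv_cancel_left₀ h]
  exact integral_add_left_eq_self (fun τ => fT (τ, k)) a

/-- If all shifts of the angles change an integral by at most `b`, then so does the replacement of
the density by its average over the angles. -/
lemma abs_integral_sub_angleAverage_le {d : ℕ} {fT : Torus d × Eucl d → ℝ}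
    (hfT : Continuous fT) {Kc : Set (Eucl d)} (hKc : IsCompact Kc)
    (hfK : ∀ τ, ∀ k ∉ Kc, fT (τ, k) = 0) {h : Eucl d × Eucl d → ℝ} (hh : Continuous h)
    {Ω : Eucl d → Eucl d} (hΩ : Continuous Ω) {t b : ℝ}
    (hb : ∀ e ∈ torusBox d,
      |(∫ z in torusBox d ×ˢ univ, h z * torusLift fT (z.1 + e - t • Ω z.2, z.2)) -
        ∫ z in torusBox d ×ˢ univ, h z * torusLift fT (z.1 - t • Ω z.2, z.2)| ≤ b) :
    |(∫ z in torusBox d ×ˢ univ, h z * torusLift fT (z.1 - t • Ω z.2, z.2)) -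
        ∫ z in torusBox d ×ˢ univ, h z * angleAverage fT z.2| ≤ b := by
  set Q := torusBox d
  have hQm := measurableSet_torusBox d
  have hp := continuous_torusProj d
  set g : Torus d → Eucl d × Eucl d → ℝ :=
    fun τ z => h z * fT (torusProj d (z.1 - t • Ω z.2) + τ, z.2) with hg
  have hgc : Continuous (Function.uncurry g) := by
    simp only [hg, Function.uncurry_def]
    fun_prop
  have hKb : Bornology.IsBounded (Q ×ˢ Kc) := (isBounded_torusBox d).prod hKc.isBounded
  have hcpt : IsCompact ((univ : Set (Torus d)) ×ˢ closure (Q ×ˢ Kc)) :=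
    isCompact_univ.prod hKb.isCompact_closure
  have hgi : Integrable (Function.uncurry g)
      ((volume : Measure (Torus d)).prod (volume.restrict (Q ×ˢ (univ : Set (Eucl d))))) := by
    have h1 : IntegrableOn (Function.uncurry g) ((univ : Set (Torus d)) ×ˢ (Q ×ˢ Kc))
        (volume.prod volume) :=
      (hgc.continuousOn.integrableOn_compact hcpt).mono_set
        (prod_mono_right subset_closure)
    rw [← Measure.restrict_univ (μ := (volume : Measure (Torus d))), Measure.prod_restrict]
    rw [← integrable_indicator_iff (MeasurableSet.univ.prod (hQm.prod hKc.measurableSet))] at h1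
    change IntegrableOn _ _ _
    rw [← integrable_indicator_iff (MeasurableSet.univ.prod (hQm.prod MeasurableSet.univ))]
    refine h1.congr (ae_of_all _ fun p => ?_)
    obtain ⟨τ, q, k⟩ := p
    by_cases hk : k ∈ Kc
    · by_cases hq : q ∈ Q
      · have m1 : (τ, q, k) ∈ (univ : Set (Torus d)) ×ˢ (Q ×ˢ Kc) := ⟨mem_univ _, hq, hk⟩
        have m2 : (τ, q, k) ∈ (univ : Set (Torus d)) ×ˢ (Q ×ˢ (univ : Set (Eucl d))) :=
          ⟨mem_univ _, hq, mem_univ _⟩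
        rw [indicator_of_mem m1, indicator_of_mem m2]
      · rw [indicator_of_notMem fun h => hq h.2.1, indicator_of_notMem fun h => hq h.2.1]
    · have hz : Function.uncurry g (τ, q, k) = 0 := by simp [hg, Function.uncurry, hfK _ _ hk]
      rw [indicator_apply_eq_zero.2 fun _ => hz, indicator_apply_eq_zero.2 fun _ => hz]
  have hswap := integral_integral_swap hgi
  -- By translation invariance on the torus, averaging over all shifts `τ` erases the time-dependent
  -- phase and leaves the angle average.
  have hinner : ∀ z, ∫ τ, g τ z = (2 * π) ^ d * (h z * angleAverage fT z.2) := by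
    intro z
    simp only [hg]
    rw [integral_const_mul, integral_torus_translate]
    ring
  simp only [hinner, integral_const_mul] at hswap
  set I₀ := ∫ z in Q ×ˢ univ, h z * torusLift fT (z.1 - t • Ω z.2, z.2) with hI₀
  set Ī := ∫ z in Q ×ˢ univ, h z * angleAverage fT z.2
  have hpos : (0 : ℝ) < (2 * π) ^ d := by positivity
  have hτ : ∀ τ, |(∫ z in Q ×ˢ univ, g τ z) - I₀| ≤ b := by
    intro τ
    obtain ⟨e, he, rfl⟩ := exists_mem_torusBox τ
    have : ∀ z, g (torusProj d e) z = h z * torusLift fT (z.1 + e - t • Ω z.2, z.2) := by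
      intro z
      simp only [hg, torusLift]
      rw [← torusProj_add]
      congr 4
      abel
    simp only [this]
    exact hb e he
  have hgint : Integrable fun τ => ∫ z in Q ×ˢ univ, g τ z := hgi.integral_prod_left
  -- Integrating the differences over all shifts turns the shifted integrals into the averaged one,
  -- so the bound for each shift is inherited by the average.
  have hdiff : ∫ τ : Torus d, ((∫ z in Q ×ˢ univ, g τ z) - I₀) = (2 * π) ^ d * (Ī - I₀) := by
    rw [integral_sub hgint (integrable_const _), hswap, integral_const, volume_real_univ_torus,
      smul_eq_mul]
    ring
  have hle : ‖∫ τ : Torus d, ((∫ z in Q ×ˢ univ, g τ z) - I₀)‖ ≤ b * (2 * π) ^ d := by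
    have := norm_integral_le_of_norm_le_const (μ := (volume : Measure (Torus d)))
      (f := fun τ => (∫ z in Q ×ˢ univ, g τ z) - I₀) (C := b) (ae_of_all _ hτ)
    rwa [volume_real_univ_torus] at this
  rw [hdiff, norm_mul, Real.norm_of_nonneg hpos.le, mul_comm, mul_le_mul_iff_left₀ hpos,
    Real.norm_eq_abs, abs_sub_comm] at hle
  exact hle

/-- The shifted density and its average over the angles have the same mass. -/
lemma integral_shift_eq_integral_angleAverage {d : ℕ} {fT : Torus d × Eucl d → ℝ}
    (hfT : Continuous fT) {Kc : Set (Eucl d)} (hKc : IsCompact Kc)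
    (hfK : ∀ τ, ∀ k ∉ Kc, fT (τ, k) = 0) (hav : Continuous (angleAverage fT))
    {Ω : Eucl d → Eucl d} (hΩ : Continuous Ω) (t : ℝ) :
    ∫ z in torusBox d ×ˢ univ, torusLift fT (z.1 - t • Ω z.2, z.2) =
      ∫ z in torusBox d ×ˢ (univ : Set (Eucl d)), angleAverage fT z.2 := by
  have hp := continuous_torusProj d
  have hc1 : Continuous fun z : Eucl d × Eucl d => torusLift fT (z.1 - t • Ω z.2, z.2) := by
    unfold torusLift; fun_prop
  have i1 := hc1.integrableOn_strip (measurableSet_torusBox d) (isBounded_torusBox d) hKc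
    fun z hz => hfK _ _ hz
  have hc2 : Continuous fun z : Eucl d × Eucl d => angleAverage fT z.2 := by fun_prop
  have i2 := hc2.integrableOn_strip (measurableSet_torusBox d)
    (isBounded_torusBox d) hKc fun z hz => by simp [angleAverage, hfK _ _ hz]
  have hpos : (0 : ℝ) < (2 * π) ^ d := by positivity
  rw [IntegrableOn, Measure.volume_eq_prod, ← Measure.prod_restrict] at i1 i2
  rw [Measure.volume_eq_prod, ← Measure.prod_restrict, integral_prod_symm _ i1,
    integral_prod_symm _ i2]
  refine integral_congr_ae (ae_of_all _ fun k => ?_)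
  simp only [integral_const, measureReal_restrict_apply_univ, volume_real_torusBox, smul_eq_mul]
  rw [← integral_torus_translate (torusProj d (-(t • Ω k)))]
  rw [← setIntegral_torusBox (g := fun τ => fT (torusProj d (-(t • Ω k)) + τ, k)) (by fun_prop)]
  refine integral_congr_ae (ae_of_all _ fun q => ?_)
  simp only [torusLift]
  rw [← torusProj_add]
  congr 3
  abel

/-! ### Extension by zero, cutoffs and frequency fields -/

lemma contDiff_of_contDiffOn_of_eq_zero {X Y : Type*} [NormedAddCommGroup X] [NormedSpace ℝ X]
    [NormedAddCommGroup Y] [NormedSpace ℝ Y] {u : X → Y} {O C : Set X} (hO : IsOpen O)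
    (hC : IsClosed C) (hCO : C ⊆ O) (hu : ContDiffOn ℝ 1 u O) (hz : ∀ x ∉ C, u x = 0) :
    ContDiff ℝ 1 u := by
  rw [contDiff_iff_contDiffAt]
  intro x
  by_cases hx : x ∈ O
  · exact hu.contDiffAt (hO.mem_nhds hx)
  · have hxC : x ∈ Cᶜ := fun h => hx (hCO h)
    refine (contDiffAt_const (c := (0 : Y))).congr_of_eventuallyEq ?_
    filter_upwards [hC.isOpen_compl.mem_nhds hxC] with y hy
    exact hz y hy

/-- The cutoff equals `1` near `C`, not only on it, so multiplying by it does not change derivatives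
at points of `C`. -/
lemma exists_cutoff {d : ℕ} {C K : Set (Eucl d)} (hC : IsCompact C) (hK : IsOpen K) (hCK : C ⊆ K) :
    ∃ (K₁ : Set (Eucl d)) (χ : Eucl d → ℝ), IsCompact K₁ ∧ C ⊆ K₁ ∧ K₁ ⊆ K ∧ ContDiff ℝ 1 χ ∧
      (∀ᶠ x in 𝓝ˢ C, χ x = 1) ∧ ∀ x ∉ K₁, χ x = 0 := by
  obtain ⟨K₁, hK₁, hC₁, hK₁K⟩ := exists_compact_between hC hK hCK
  obtain ⟨f, h1, h0, -⟩ := exists_contMDiffMap_one_nhds_of_subset_interior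
    (modelWithCornersSelf ℝ (Eucl d)) (n := 1) hC.isClosed hC₁
  exact ⟨K₁, f, hK₁, hC₁.trans interior_subset, hK₁K, f.contMDiff.contDiff, h1, h0⟩

/-- Two derivatives of `ω` are needed for this: `Dω` must be `C¹` so that its inverse, and with it
the field used in the integration by parts, is `C¹`. -/
lemma contDiffOn_inverse_fderiv {d : ℕ} {K : Set (Eucl d)} (hK : IsOpen K) {ω : Eucl d → Eucl d}
    (hω : ContDiffOn ℝ 2 ω K) (hdet : ∀ k ∈ K, (fderiv ℝ ω k).det ≠ 0) :
    ContDiffOn ℝ 1 (fun k => ContinuousLinearMap.inverse (fderiv ℝ ω k)) K := by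
  intro k hk
  refine ContDiffAt.contDiffWithinAt ?_
  have h1 : ContDiffAt ℝ 1 (fderiv ℝ ω) k :=
    (hω.contDiffAt (hK.mem_nhds hk)).fderiv_right (by norm_num)
  have h2 := contDiffAt_map_inverse (n := 1)
    ((fderiv ℝ ω k).toContinuousLinearEquivOfDetNeZero (hdet k hk))
  rw [ContinuousLinearMap.coe_toContinuousLinearEquivOfDetNeZero] at h2
  exact h2.comp k h1

lemma inverse_fderiv_apply {d : ℕ} {L : Eucl d →L[ℝ] Eucl d} (hL : L.det ≠ 0) (e : Eucl d) :
    L (ContinuousLinearMap.inverse L e) = e := by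
  have h3 := ContinuousLinearMap.inverse_equiv (L.toContinuousLinearEquivOfDetNeZero hL)
  rw [ContinuousLinearMap.coe_toContinuousLinearEquivOfDetNeZero] at h3
  rw [h3]
  exact (L.toContinuousLinearEquivOfDetNeZero hL).apply_symm_apply e

/-- Linearity in `e` makes the bounds uniform over all shifts of bounded length. -/
lemma exists_bound_operator_field {d : ℕ} {P : Eucl d → (Eucl d →L[ℝ] Eucl d)}
    (hP : ContDiff ℝ 1 P) (hPc : HasCompactSupport P) :
    ∃ B : ℝ, 0 ≤ B ∧ (∀ k, ‖P k‖ ≤ B) ∧ ∀ k e, ‖fderiv ℝ (fun k => P k e) k‖ ≤ B * ‖e‖ := by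
  obtain ⟨B₁, hB₁⟩ := hP.continuous.bounded_above_of_compact_support hPc
  obtain ⟨B₂, hB₂⟩ := (hP.continuous_fderiv one_ne_zero).bounded_above_of_compact_support
    (hPc.fderiv ℝ)
  refine ⟨max B₁ B₂, (norm_nonneg _).trans ((hB₁ 0).trans (le_max_left _ _)),
    fun k => (hB₁ k).trans (le_max_left _ _), fun k e => ?_⟩
  have h4 : fderiv ℝ (fun k => P k e) k = (ContinuousLinearMap.apply ℝ (Eucl d) e).comp
      (fderiv ℝ P k) :=
    ((ContinuousLinearMap.apply ℝ (Eucl d) e).hasFDerivAt.comp k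
      ((hP.differentiable one_ne_zero) k).hasFDerivAt).fderiv
  rw [h4]
  have h0 : 0 ≤ max B₁ B₂ := (norm_nonneg _).trans ((hB₁ 0).trans (le_max_left _ _))
  refine ContinuousLinearMap.opNorm_le_bound _ (mul_nonneg h0 (norm_nonneg e)) fun v => ?_
  have h5 : ‖fderiv ℝ P k v e‖ ≤ ‖fderiv ℝ P k‖ * ‖v‖ * ‖e‖ := (fderiv ℝ P k).le_opNorm₂ v e
  refine h5.trans ?_
  have h6 := (hB₂ k).trans (le_max_right B₁ B₂)
  calc ‖fderiv ℝ P k‖ * ‖v‖ * ‖e‖ ≤ max B₁ B₂ * ‖v‖ * ‖e‖ := by gcongr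
    _ = _ := by ring

/-- A compactly supported vector field that moves the frequencies in a prescribed direction. -/
lemma exists_frequency_fields {d : ℕ} {K Kc : Set (Eucl d)} (hK : IsOpen K) (hKc : IsCompact Kc)
    (hKcK : Kc ⊆ K) {ω : Eucl d → Eucl d} (hω : ContDiffOn ℝ 2 ω K)
    (hdet : ∀ k ∈ K, (fderiv ℝ ω k).det ≠ 0) (D : ℝ) :
    ∃ (K₁ : Set (Eucl d)) (Ω : Eucl d → Eucl d) (w : Eucl d → Eucl d → Eucl d) (a : ℝ),
      IsCompact K₁ ∧ Kc ⊆ K₁ ∧ K₁ ⊆ K ∧ ContDiff ℝ 1 Ω ∧ (∀ k ∈ Kc, Ω k = ω k) ∧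
      ∀ e, ‖e‖ ≤ D → ContDiff ℝ 1 (w e) ∧ (∀ k ∉ K₁, w e k = 0) ∧
        (∀ k ∈ Kc, fderiv ℝ Ω k (w e k) = e) ∧ (∀ k, ‖w e k‖ ≤ a) ∧
        (∀ k, ‖fderiv ℝ (w e) k‖ ≤ a) ∧ ‖e‖ ≤ a := by
  obtain ⟨K₁, χ, hK₁, hKc₁, hK₁K, hχ, hχ1, hχ0⟩ := exists_cutoff hKc hK hKcK
  set Ω : Eucl d → Eucl d := fun k => χ k • ω k with hΩ
  have hΩC : ContDiff ℝ 1 Ω := contDiff_of_contDiffOn_of_eq_zero hK hK₁.isClosed hK₁K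
    (hχ.contDiffOn.smul (hω.of_le (by norm_num))) fun k hk => by simp [hΩ, hχ0 k hk]
  obtain ⟨R, hR, hRω⟩ : ∃ R : Eucl d → (Eucl d →L[ℝ] Eucl d), ContDiffOn ℝ 1 R K ∧
      ∀ k ∈ K, ∀ e, fderiv ℝ ω k (R k e) = e :=
    ⟨_, contDiffOn_inverse_fderiv hK hω hdet, fun k hk e => inverse_fderiv_apply (hdet k hk) e⟩
  -- The field is `w e k = χ k • (Dω k)⁻¹ e`, which inverts the derivative of the frequencies
  -- wherever `χ` is `1`.
  set P : Eucl d → (Eucl d →L[ℝ] Eucl d) := fun k => χ k • R k with hP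
  have hP0 : ∀ k ∉ K₁, P k = 0 := fun k hk =>
    ContinuousLinearMap.ext fun v => by simp [hP, hχ0 k hk]
  have hPC : ContDiff ℝ 1 P := contDiff_of_contDiffOn_of_eq_zero hK hK₁.isClosed hK₁K
    (hχ.contDiffOn.smul hR) hP0
  have hPc : HasCompactSupport P := HasCompactSupport.intro hK₁ hP0
  obtain ⟨B, hB0, hB, hB'⟩ := exists_bound_operator_field hPC hPc
  have hDB : ∀ e : Eucl d, ‖e‖ ≤ D → B * ‖e‖ ≤ (B + 1) * D := fun e he =>
    mul_le_mul (by linarith) he (norm_nonneg _) (by linarith)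
  -- The constant `(B + 1) * D` dominates both `B * ‖e‖`, for the field and its derivative, and
  -- `‖e‖` itself.
  refine ⟨K₁, Ω, fun e k => P k e, (B + 1) * D, hK₁, hKc₁, hK₁K, hΩC, ?_, ?_⟩
  · intro k hk
    simp [hΩ, hχ1.self_of_nhdsSet k hk]
  intro e he
  refine ⟨hPC.clm_apply contDiff_const, ?_, ?_, ?_, ?_, ?_⟩
  · intro k hk; simp only [hP0 k hk, zero_apply]
  · intro k hk
    have hev : Ω =ᶠ[𝓝 k] ω := by
      filter_upwards [(eventually_nhdsSet_iff_forall.1 hχ1) k hk] with x hx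
      simp [hΩ, hx]
    have hPk : P k = R k :=
      ContinuousLinearMap.ext fun v => by simp [hP, hχ1.self_of_nhdsSet k hk]
    simp only
    rw [hev.fderiv_eq, hPk]
    exact hRω k (hKcK hk) e
  · intro k
    exact ((P k).le_opNorm e).trans
      ((mul_le_mul_of_nonneg_right (hB k) (norm_nonneg _)).trans (hDB e he))
  · intro k
    exact (hB' k e).trans (hDB e he)
  · have hD : 0 ≤ D := (norm_nonneg _).trans he
    exact he.trans (le_mul_of_one_le_left hD (by linarith))

/-! ### Transport of densities by the action-angle map -/

section ActionAngle

variable {d : ℕ} {K : Set (Eucl d)} {G : Set (Phase d)} {U : Eucl d → ℝ} {ω : Eucl d → Eucl d}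
  {N : OpenPartialHomeomorph (Torus d × Eucl d) (Phase d)} {F₀ : Phase d → ℝ}
  {F : ℝ → Phase d → ℝ}

lemma IsC1Diffeo.torusLift_mem (hN : IsC1Diffeo N K G) (q : Eucl d) {k : Eucl d} (hk : k ∈ K) :
    torusLift N (q, k) ∈ G := by
  rw [← hN.target_eq]
  exact N.map_source (by rw [hN.source_eq]; exact ⟨mem_univ _, hk⟩)

lemma IsC1Diffeo.exists_torusLift_eq (hN : IsC1Diffeo N K G) {z : Phase d} (hz : z ∈ G) :
    ∃ q ∈ torusBox d, ∃ k ∈ K, torusLift N (q, k) = z ∧ N.symm z = (torusProj d q, k) := by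
  rw [← hN.target_eq] at hz
  have h1 := N.map_target hz
  rw [hN.source_eq] at h1
  obtain ⟨q, hq, hqz⟩ := exists_mem_torusBox (N.symm z).1
  refine ⟨q, hq, (N.symm z).2, h1.2, ?_, ?_⟩
  · simp only [torusLift, hqz]
    exact N.right_inv hz
  · rw [hqz]

lemma IsC1Diffeo.symm_torusLift (hN : IsC1Diffeo N K G) (q : Eucl d) {k : Eucl d} (hk : k ∈ K) :
    N.symm (torusLift N (q, k)) = (torusProj d q, k) :=
  N.left_inv (by rw [hN.source_eq]; exact ⟨mem_univ _, hk⟩)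

lemma IsC1Diffeo.contDiffAt_lift (hN : IsC1Diffeo N K G) (hK : IsOpen K) (q : Eucl d) {k : Eucl d}
    (hk : k ∈ K) : ContDiffAt ℝ 1 (torusLift N) (q, k) :=
  hN.contDiffOn_lift.contDiffAt ((isOpen_univ.prod hK).mem_nhds ⟨mem_univ _, hk⟩)

lemma IsC1Diffeo.hasFDerivAt_lift (hN : IsC1Diffeo N K G) (hK : IsOpen K) (q : Eucl d)
    {k : Eucl d} (hk : k ∈ K) :
    HasFDerivAt (torusLift N) (fderiv ℝ (torusLift N) (q, k)) (q, k) :=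
  ((hN.contDiffAt_lift hK q hk).differentiableAt one_ne_zero).hasFDerivAt

/-- The angle-action map preserves the Liouville measure. -/
lemma IsC1Diffeo.setIntegral_image (hN : IsC1Diffeo N K G) (hK : IsOpen K)
    (hNω : IsActionAngle U ω N K) {s : Set (Eucl d × Eucl d)} (hs : MeasurableSet s)
    (hsK : s ⊆ torusBox d ×ˢ K) (u : Phase d → ℝ) :
    ∫ z in torusLift N '' s, u z = ∫ y in s, u (torusLift N y) := by
  have hinj : InjOn (torusLift N) s := by
    intro x hx y hy hxy
    have h1 := hN.symm_torusLift x.1 (hsK hx).2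
    have h2 := hN.symm_torusLift y.1 (hsK hy).2
    rw [Prod.mk.eta] at h1 h2
    rw [hxy, h2, Prod.mk.injEq] at h1
    exact Prod.ext (injOn_torusProj d (hsK hx).1 (hsK hy).1 h1.1.symm) h1.2.symm
  have hvol : (volume : Measure (Phase d)).IsAddHaarMeasure := by
    rw [Measure.volume_eq_prod]; infer_instance
  rw [integral_image_eq_integral_abs_det_fderiv_smul volume hs
    (fun x hx => (hN.hasFDerivAt_lift hK x.1 (hsK hx).2).hasFDerivWithinAt) hinj u]
  refine setIntegral_congr_fun hs fun x hx => ?_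
  have := hNω.abs_det x.1 x.2 (hsK hx).2
  simp only [Prod.mk.eta] at this ⊢
  rw [this, one_smul]

lemma IsC1Diffeo.image_box (hN : IsC1Diffeo N K G) : torusLift N '' (torusBox d ×ˢ K) = G := by
  ext z
  constructor
  · rintro ⟨⟨q, k⟩, h, rfl⟩
    exact hN.torusLift_mem q h.2
  · intro hz
    obtain ⟨q, hq, k, hk, h, -⟩ := hN.exists_torusLift_eq hz
    exact ⟨(q, k), ⟨hq, hk⟩, h⟩

/-- Solutions of Liouville's equation are transported by the flow in action-angle variables. -/
lemma IsLiouvilleSolution.apply_torusLift (hK : IsOpen K) (hG : IsOpen G)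
    (hN : IsC1Diffeo N K G) (hNω : IsActionAngle U ω N K) (hF : IsLiouvilleSolution U G F₀ F)
    (t : ℝ) (q : Eucl d) {k : Eucl d} (hk : k ∈ K) :
    F t (torusLift N (q, k)) = F₀ (torusLift N (q - t • ω k, k)) := by
  -- The trajectory that reaches `N(q, k)` at time `t`. The solution is constant along it, so its
  -- value can be read off at time `0`.
  set γ : ℝ → Phase d := fun s => torusLift N ((q - t • ω k) + s • ω k, k) with hγ
  have hγd : ∀ s, HasDerivAt γ ((γ s).2, -gradient U (γ s).1) s := by
    intro s
    have h1 : HasDerivAt (fun s : ℝ => ((q - t • ω k) + s • ω k, k)) (ω k, (0 : Eucl d)) s := by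
      refine HasDerivAt.prodMk ?_ (hasDerivAt_const s k)
      simpa using ((hasDerivAt_id s).smul_const (ω k)).const_add (q - t • ω k)
    have h2 := (hN.hasFDerivAt_lift hK ((q - t • ω k) + s • ω k) hk).comp_hasDerivAt s h1
    rw [hNω.hamilton _ k hk] at h2
    exact h2
  have hd : ∀ s, HasDerivAt (fun s => F s (γ s)) 0 s := by
    intro s
    have hmem : γ s ∈ G := hN.torusLift_mem _ hk
    have hfd : DifferentiableAt ℝ (fun s : ℝ × Phase d => F s.1 s.2) (s, γ s) :=
      (hF.contDiffOn.contDiffAt ((isOpen_univ.prod hG).mem_nhds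
        ⟨mem_univ _, hmem⟩)).differentiableAt one_ne_zero
    set T := fderiv ℝ (fun s : ℝ × Phase d => F s.1 s.2) (s, γ s) with hT
    have hTd : HasFDerivAt (fun s : ℝ × Phase d => F s.1 s.2) T (s, γ s) := hfd.hasFDerivAt
    have h1 := hTd.comp_hasDerivAt s ((hasDerivAt_id s).prodMk (hγd s))
    have e1 : deriv (fun r => F r (γ s)) s = T (1, 0) := by
      have h2 := hTd.comp_hasDerivAt s ((hasDerivAt_id s).prodMk (hasDerivAt_const s (γ s)))
      exact HasDerivAt.deriv h2
    have e2 : ∀ v, fderiv ℝ (fun x' => F s (x', (γ s).2)) (γ s).1 v = T (0, v, 0) := by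
      intro v
      have h3 : HasFDerivAt (fun x' : Eucl d => (s, x', (γ s).2))
          ((0 : Eucl d →L[ℝ] ℝ).prod ((ContinuousLinearMap.id ℝ (Eucl d)).prod 0)) (γ s).1 :=
        (hasFDerivAt_const s _).prodMk ((hasFDerivAt_id _).prodMk (hasFDerivAt_const _ _))
      have h4 : HasFDerivAt (fun x' => F s (x', (γ s).2)) _ (γ s).1 :=
        HasFDerivAt.comp (γ s).1 (g := fun s : ℝ × Phase d => F s.1 s.2) hTd h3
      rw [h4.fderiv]; rfl
    have e3 : ∀ v, fderiv ℝ (fun p' => F s ((γ s).1, p')) (γ s).2 v = T (0, 0, v) := by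
      intro v
      have h3 : HasFDerivAt (fun p' : Eucl d => (s, (γ s).1, p'))
          ((0 : Eucl d →L[ℝ] ℝ).prod ((0 : Eucl d →L[ℝ] Eucl d).prod
            (ContinuousLinearMap.id ℝ (Eucl d)))) (γ s).2 :=
        (hasFDerivAt_const s _).prodMk ((hasFDerivAt_const _ _).prodMk (hasFDerivAt_id _))
      have h4 : HasFDerivAt (fun p' => F s ((γ s).1, p')) _ (γ s).2 :=
        HasFDerivAt.comp (γ s).2 (g := fun s : ℝ × Phase d => F s.1 s.2) hTd h3
      rw [h4.fderiv]; rfl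
    have hl := hF.liouville s (γ s).1 (γ s).2 hmem
    rw [Prod.mk.eta, e1, real_inner_comm, inner_gradient_left, e2, real_inner_comm,
      inner_gradient_left, e3] at hl
    -- Split along time, position and momentum, the derivative along the trajectory is the
    -- difference of the two sides of Liouville's equation.
    have hsplit : ((1 : ℝ), ((γ s).2, -gradient U (γ s).1)) =
        ((1 : ℝ), ((0 : Eucl d), (0 : Eucl d))) + (0, (γ s).2, 0) - (0, 0, gradient U (γ s).1) := by
      simp
    rw [hsplit, map_sub, map_add] at h1
    have h10 : T ((1 : ℝ), ((0 : Eucl d), (0 : Eucl d))) = T (1, 0) := rfl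
    convert! h1 using 1
    rw [h10, hl]; ring
  have hconst := is_const_of_deriv_eq_zero (fun s => (hd s).differentiableAt)
    (fun s => (hd s).deriv) t 0
  simp only [hγ, hF.initial, sub_add_cancel, zero_smul, add_zero] at hconst
  exact hconst

/-- The initial density in action-angle variables, extended by zero. -/
def angleDensity (N : OpenPartialHomeomorph (Torus d × Eucl d) (Phase d)) (F₀ : Phase d → ℝ) :
    Torus d × Eucl d → ℝ := N.source.indicator fun y => F₀ (N y)

/-- The actions in the support of a density. -/
def actionSupport (N : OpenPartialHomeomorph (Torus d × Eucl d) (Phase d)) (F₀ : Phase d → ℝ) :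
    Set (Eucl d) := Prod.snd '' (N.symm '' tsupport F₀)

lemma IsC1Diffeo.isCompact_actionSupport (hN : IsC1Diffeo N K G) (hF₀c : HasCompactSupport F₀)
    (hF₀G : tsupport F₀ ⊆ G) : IsCompact (actionSupport N F₀) := by
  refine IsCompact.image ?_ continuous_snd
  refine hF₀c.isCompact.image_of_continuousOn (N.continuousOn_symm.mono ?_)
  rwa [hN.target_eq]

lemma IsC1Diffeo.actionSupport_subset (hN : IsC1Diffeo N K G) (hF₀G : tsupport F₀ ⊆ G) :
    actionSupport N F₀ ⊆ K := by
  rintro _ ⟨_, ⟨z, hz, rfl⟩, rfl⟩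
  have h1 := N.map_target (by rw [hN.target_eq]; exact hF₀G hz)
  rw [hN.source_eq] at h1
  exact h1.2

lemma angleDensity_eq_zero (τ : Torus d) {k : Eucl d} (hk : k ∉ actionSupport N F₀) :
    angleDensity N F₀ (τ, k) = 0 := by
  by_contra hne
  have hs : (τ, k) ∈ N.source := by
    by_contra h; exact hne (indicator_of_notMem h _)
  rw [angleDensity, indicator_of_mem hs] at hne
  exact hk ⟨N.symm (N (τ, k)), ⟨_, subset_tsupport _ hne, rfl⟩, by rw [N.left_inv hs]⟩

lemma IsC1Diffeo.angleDensity_apply (hN : IsC1Diffeo N K G) (τ : Torus d) {k : Eucl d}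
    (hk : k ∈ K) : angleDensity N F₀ (τ, k) = F₀ (N (τ, k)) :=
  indicator_of_mem (by rw [hN.source_eq]; exact ⟨mem_univ _, hk⟩) _

lemma IsC1Diffeo.continuous_angleDensity (hN : IsC1Diffeo N K G)
    (hF₀ : Continuous F₀) (hF₀c : HasCompactSupport F₀) (hF₀G : tsupport F₀ ⊆ G) :
    Continuous (angleDensity N F₀) := by
  have hKc := hN.isCompact_actionSupport hF₀c hF₀G
  rw [continuous_iff_continuousAt]
  rintro ⟨τ, k⟩
  by_cases hs : (τ, k) ∈ N.source
  · have h1 : ContinuousAt (fun y => F₀ (N y)) (τ, k) :=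
      hF₀.continuousAt.comp (N.continuousAt hs)
    refine h1.congr ?_
    filter_upwards [N.open_source.mem_nhds hs] with y hy
    exact (indicator_of_mem hy fun y => F₀ (N y)).symm
  · have hk : k ∉ actionSupport N F₀ := fun h => hs (by
      rw [hN.source_eq]; exact ⟨mem_univ _, hN.actionSupport_subset hF₀G h⟩)
    refine (continuousAt_const (y := (0 : ℝ)) (x := (τ, k))).congr ?_
    filter_upwards [(isOpen_univ.prod hKc.isClosed.isOpen_compl).mem_nhds
      (show (τ, k) ∈ (univ : Set (Torus d)) ×ˢ (actionSupport N F₀)ᶜ from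
        ⟨mem_univ τ, hk⟩)] with y hy
    exact (angleDensity_eq_zero y.1 hy.2).symm

lemma IsC1Diffeo.contDiff_torusLift_angleDensity (hN : IsC1Diffeo N K G) (hK : IsOpen K)
    (hF₀ : ContDiff ℝ 1 F₀) (hF₀c : HasCompactSupport F₀) (hF₀G : tsupport F₀ ⊆ G) :
    ContDiff ℝ 1 (torusLift (angleDensity N F₀)) := by
  have hKc := hN.isCompact_actionSupport hF₀c hF₀G
  refine contDiff_of_contDiffOn_of_eq_zero (O := univ ×ˢ K) (C := univ ×ˢ actionSupport N F₀)
    (isOpen_univ.prod hK) (isClosed_univ.prod hKc.isClosed)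
    (prod_mono_right (hN.actionSupport_subset hF₀G)) ?_ fun y hy => ?_
  · refine (hF₀.comp_contDiffOn hN.contDiffOn_lift).congr fun y hy => ?_
    exact hN.angleDensity_apply _ hy.2
  · exact angleDensity_eq_zero _ fun h => hy ⟨mem_univ _, h⟩

/-- The lift is not compactly supported, but it is periodic in the angles and vanishes outside a
compact set of actions. Its bounds are therefore attained over a compact period cell. -/
lemma IsC1Diffeo.exists_bound_angleDensity (hN : IsC1Diffeo N K G) (hK : IsOpen K)
    (hF₀ : ContDiff ℝ 1 F₀) (hF₀c : HasCompactSupport F₀) (hF₀G : tsupport F₀ ⊆ G) :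
    ∃ A : ℝ, (∀ z, |torusLift (angleDensity N F₀) z| ≤ A) ∧
      ∀ z, ‖fderiv ℝ (torusLift (angleDensity N F₀)) z‖ ≤ A := by
  set f := torusLift (angleDensity N F₀) with hf
  have hKc := hN.isCompact_actionSupport hF₀c hF₀G
  have hC := hN.contDiff_torusLift_angleDensity hK hF₀ hF₀c hF₀G
  have hC' : Continuous (fderiv ℝ f) := hC.continuous_fderiv one_ne_zero
  have hcpt : IsCompact (closure (torusBox d) ×ˢ actionSupport N F₀) :=
    (isBounded_torusBox d).isCompact_closure.prod hKc
  obtain ⟨A₁, hA₁⟩ := hcpt.exists_bound_of_continuousOn hC.continuous.continuousOn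
  obtain ⟨A₂, hA₂⟩ := hcpt.exists_bound_of_continuousOn hC'.continuousOn
  have hper : ∀ (a b : Eucl d), torusProj d a = torusProj d b →
      (fun z : Eucl d × Eucl d => f (z + (a - b, 0))) = f := by
    intro a b hab
    ext z
    simp only [hf, torusLift, Prod.fst_add, Prod.snd_add, add_zero]
    congr 2
    ext i
    have := congrFun hab i
    simp only [torusProj, PiLp.add_apply, PiLp.sub_apply, AddCircle.coe_add, AddCircle.coe_sub] at this ⊢
    rw [this]; simp
  have hmax : (0 : ℝ) ≤ max (max A₁ A₂) 0 := le_max_right _ _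
  have hzero : ∀ z : Eucl d × Eucl d, z.2 ∉ actionSupport N F₀ →
      f z = 0 ∧ fderiv ℝ f z = 0 := by
    intro z hz
    have hev : f =ᶠ[𝓝 z] fun _ => 0 := by
      filter_upwards [(isOpen_univ.prod hKc.isClosed.isOpen_compl).mem_nhds
        (⟨mem_univ z.1, hz⟩ : z ∈ univ ×ˢ (actionSupport N F₀)ᶜ)] with y hy
      exact angleDensity_eq_zero _ hy.2
    exact ⟨hev.self_of_nhds, by rw [hev.fderiv_eq]; simp⟩
  have hred : ∀ z : Eucl d × Eucl d, z.2 ∈ actionSupport N F₀ →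
      ∃ y ∈ closure (torusBox d) ×ˢ actionSupport N F₀, f z = f y ∧
        fderiv ℝ f z = fderiv ℝ f y := by
    intro z hz
    obtain ⟨q, hq, hqz⟩ := exists_mem_torusBox (torusProj d z.1)
    have hp := hper z.1 q hqz.symm
    have hzq : (q, z.2) + (z.1 - q, (0 : Eucl d)) = z := by ext <;> simp
    refine ⟨(q, z.2), ⟨subset_closure hq, hz⟩, ?_, ?_⟩
    · have := congrFun hp (q, z.2)
      simp only [hzq] at this
      exact this
    · have := fderiv_comp_add_right (𝕜 := ℝ) (f := f) (x := (q, z.2)) (z.1 - q, 0)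
      rw [hp, hzq] at this
      exact this.symm
  refine ⟨max (max A₁ A₂) 0, fun z => ?_, fun z => ?_⟩
  · by_cases hz : z.2 ∈ actionSupport N F₀
    · obtain ⟨y, hy, h1, -⟩ := hred z hz
      rw [h1]
      exact (hA₁ y hy).trans ((le_max_left _ _).trans (le_max_left _ _))
    · rw [(hzero z hz).1, abs_zero]; exact hmax
  · by_cases hz : z.2 ∈ actionSupport N F₀
    · obtain ⟨y, hy, -, h1⟩ := hred z hz
      rw [h1]
      exact (hA₂ y hy).trans ((le_max_right _ _).trans (le_max_left _ _))
    · rw [(hzero z hz).2, norm_zero]; exact hmax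

/-- Angle averages of a `C¹` density are `C¹` in the actions. -/
lemma contDiff_angleAverage {fT : Torus d × Eucl d → ℝ} (hfT : Continuous fT)
    (hf : ContDiff ℝ 1 (torusLift fT)) : ContDiff ℝ 1 (angleAverage fT) := by
  obtain ⟨K₁, χ, hK₁, -, -, hχ, hχ1, hχ0⟩ := exists_cutoff
    (isBounded_torusBox d).isCompact_closure isOpen_univ (subset_univ _)
  -- The average is a convolution, evaluated at `0`, with the indicator of the period cell. The
  -- cutoff `χ` supplies the compact support required in the angles and equals `1` on the cell.
  have h := contDiffOn_convolution_right_with_param_comp (n := 1) (μ := (volume : Measure (Eucl d)))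
    (𝕜 := ℝ) (P := Eucl d) (s := univ) (f := (torusBox d).indicator fun _ => (1 : ℝ))
    (g := fun k p => χ (-p) * torusLift fT (-p, k)) (v := fun _ => (0 : Eucl d))
    (ContinuousLinearMap.lsmul ℝ ℝ) contDiffOn_const isOpen_univ hK₁.neg
    (fun k p _ hp => by rw [hχ0 _ (by simpa using hp), zero_mul])
    ((locallyIntegrable_const (1 : ℝ)).indicator (measurableSet_torusBox d)) (by
      have : ContDiff ℝ 1 fun z : Eucl d × Eucl d => χ (-z.2) * torusLift fT (-z.2, z.1) :=
        (hχ.comp contDiff_snd.neg).mul (hf.comp (contDiff_snd.neg.prodMk contDiff_fst))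
      exact_mod_cast this.contDiffOn)
  rw [contDiffOn_univ] at h
  have e : angleAverage fT = fun k => ((2 * π) ^ d)⁻¹ *
      convolution ((torusBox d).indicator fun _ => (1 : ℝ))
        (fun p => χ (-p) * torusLift fT (-p, k)) (ContinuousLinearMap.lsmul ℝ ℝ) volume 0 := by
    ext k
    rw [convolution_lsmul, angleAverage]
    congr 1
    rw [← setIntegral_torusBox (g := fun τ => fT (τ, k)) (by fun_prop),
      ← integral_indicator (measurableSet_torusBox d)]
    refine integral_congr_ae (ae_of_all _ fun q => ?_)
    by_cases hq : q ∈ torusBox d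
    · simp [hq, torusLift, hχ1.self_of_nhdsSet q (subset_closure hq)]
    · simp [hq]
  rw [e]
  exact contDiff_const.mul (by exact_mod_cast h)

/-- The actions are `C¹` functions of position and momentum. -/
lemma IsC1Diffeo.contDiffOn_symm_snd (hN : IsC1Diffeo N K G) (hK : IsOpen K) :
    ContDiffOn ℝ 1 (fun z => (N.symm z).2) G := by
  intro z hz
  obtain ⟨q, -, k, hk, rfl, -⟩ := hN.exists_torusLift_eq hz
  refine ContDiffAt.contDiffWithinAt ?_
  have h1 := hN.contDiffAt_lift hK q hk
  have h2 := hN.hasFDerivAt_lift hK q hk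
  set L := (fderiv ℝ (torusLift N) (q, k)).toContinuousLinearEquivOfDetNeZero
    (hN.det_ne_zero q k hk) with hL
  have h2' : HasFDerivAt (torusLift N) (L : Eucl d × Eucl d →L[ℝ] Phase d) (q, k) := by
    rw [hL, ContinuousLinearMap.coe_toContinuousLinearEquivOfDetNeZero]; exact h2
  have hst := h1.hasStrictFDerivAt' h2' one_ne_zero
  have h3 : ContDiffAt ℝ 1 (hst.localInverse (torusLift N) L (q, k)) (torusLift N (q, k)) :=
    h1.to_localInverse h2' one_ne_zero
  refine (contDiffAt_snd.comp _ h3).congr_of_eventuallyEq ?_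
  -- Near the point, the local inverse of the lift takes values in the domain of `N`; injectivity of
  -- `N` then identifies its projection with `N.symm`, and the action component needs no projection.
  have h4 : ∀ᶠ y in 𝓝 (torusLift N (q, k)),
      hst.localInverse (torusLift N) L (q, k) y ∈ univ ×ˢ K :=
    hst.localInverse_tendsto ((isOpen_univ.prod hK).mem_nhds ⟨mem_univ _, hk⟩)
  filter_upwards [h4, hst.eventually_right_inverse] with y hy1 hy2
  have h5 := hN.symm_torusLift (hst.localInverse (torusLift N) L (q, k) y).1 hy1.2
  rw [Prod.mk.eta, hy2] at h5
  rw [h5]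
  rfl

/-- The region of phase space swept out by the support of the initial density. -/
def sweptSupport (N : OpenPartialHomeomorph (Torus d × Eucl d) (Phase d)) (F₀ : Phase d → ℝ) :
    Set (Phase d) := N '' (univ ×ˢ actionSupport N F₀)

lemma IsC1Diffeo.isCompact_sweptSupport (hN : IsC1Diffeo N K G) (hF₀c : HasCompactSupport F₀)
    (hF₀G : tsupport F₀ ⊆ G) : IsCompact (sweptSupport N F₀) := by
  refine (isCompact_univ.prod (hN.isCompact_actionSupport hF₀c hF₀G)).image_of_continuousOn
    (N.continuousOn.mono ?_)
  rw [hN.source_eq]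
  exact prod_mono_right (hN.actionSupport_subset hF₀G)

lemma IsC1Diffeo.sweptSupport_subset (hN : IsC1Diffeo N K G) (hF₀G : tsupport F₀ ⊆ G) :
    sweptSupport N F₀ ⊆ G := by
  rintro _ ⟨y, hy, rfl⟩
  rw [← hN.target_eq]
  refine N.map_source ?_
  rw [hN.source_eq]
  exact ⟨mem_univ _, hN.actionSupport_subset hF₀G hy.2⟩

lemma IsC1Diffeo.mem_sweptSupport_of (hN : IsC1Diffeo N K G) {b : Phase d → ℝ}
    (hbG : ∀ z ∉ G, b z = 0)
    (hb : ∀ q, ∀ k ∈ K, k ∉ actionSupport N F₀ → b (torusLift N (q, k)) = 0) :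
    ∀ z ∉ sweptSupport N F₀, b z = 0 := by
  intro z hz
  by_cases hzG : z ∈ G
  · obtain ⟨q, -, k, hk, rfl, -⟩ := hN.exists_torusLift_eq hzG
    refine hb q k hk fun hkc => hz ⟨(torusProj d q, k), ⟨mem_univ _, hkc⟩, rfl⟩
  · exact hbG z hzG

lemma IsC1Diffeo.averagedDensity_torusLift (hN : IsC1Diffeo N K G) (q : Eucl d) {k : Eucl d}
    (hk : k ∈ K) :
    averagedDensity N F₀ (torusLift N (q, k)) = angleAverage (angleDensity N F₀) k := by
  rw [averagedDensity, indicator_of_mem (by rw [hN.target_eq]; exact hN.torusLift_mem q hk),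
    hN.symm_torusLift q hk]
  simp only [angleAverage]
  congr 1
  refine integral_congr_ae (ae_of_all _ fun τ => ?_)
  exact (hN.angleDensity_apply τ hk).symm

lemma IsC1Diffeo.averagedDensity_regular (hN : IsC1Diffeo N K G) (hK : IsOpen K) (hG : IsOpen G)
    (hF₀ : ContDiff ℝ 1 F₀) (hF₀c : HasCompactSupport F₀) (hF₀G : tsupport F₀ ⊆ G) :
    ContDiff ℝ 1 (averagedDensity N F₀) ∧
      ∀ z ∉ sweptSupport N F₀, averagedDensity N F₀ z = 0 := by
  have hz : ∀ z ∉ sweptSupport N F₀, averagedDensity N F₀ z = 0 := by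
    refine hN.mem_sweptSupport_of (fun z hz => indicator_of_notMem (by rwa [hN.target_eq]) _) ?_
    intro q k hk hkc
    rw [hN.averagedDensity_torusLift q hk, angleAverage]
    simp [angleDensity_eq_zero _ hkc]
  refine ⟨contDiff_of_contDiffOn_of_eq_zero hG
    (hN.isCompact_sweptSupport hF₀c hF₀G).isClosed (hN.sweptSupport_subset hF₀G) ?_ hz, hz⟩
  have h1 := contDiff_angleAverage (hN.continuous_angleDensity hF₀.continuous hF₀c hF₀G)
    (hN.contDiff_torusLift_angleDensity hK hF₀ hF₀c hF₀G)
  refine (h1.comp_contDiffOn (hN.contDiffOn_symm_snd hK)).congr fun z hz => ?_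
  obtain ⟨q, -, k, hk, rfl, h⟩ := hN.exists_torusLift_eq hz
  rw [hN.averagedDensity_torusLift q hk, Function.comp, h]

lemma IsLiouvilleSolution.apply_eq_angleDensity (hK : IsOpen K) (hG : IsOpen G)
    (hN : IsC1Diffeo N K G) (hNω : IsActionAngle U ω N K) (hF : IsLiouvilleSolution U G F₀ F)
    (t : ℝ) (q : Eucl d) {k : Eucl d} (hk : k ∈ K) :
    F t (torusLift N (q, k)) = torusLift (angleDensity N F₀) (q - t • ω k, k) := by
  rw [hF.apply_torusLift hK hG hN hNω t q hk]
  exact (hN.angleDensity_apply _ hk).symm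

/-- The actions are conserved, so the support remains in one compact subset of `G`, the same for all
times, and the extension by zero stays `C¹`. -/
lemma IsLiouvilleSolution.regular (hK : IsOpen K) (hG : IsOpen G) (hN : IsC1Diffeo N K G)
    (hNω : IsActionAngle U ω N K) (hF : IsLiouvilleSolution U G F₀ F)
    (hF₀c : HasCompactSupport F₀) (hF₀G : tsupport F₀ ⊆ G) (t : ℝ) :
    ContDiff ℝ 1 (F t) ∧ ∀ z ∉ sweptSupport N F₀, F t z = 0 := by
  have hz : ∀ z ∉ sweptSupport N F₀, F t z = 0 := by
    refine hN.mem_sweptSupport_of (hF.eq_zero t) fun q k hk hkc => ?_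
    rw [hF.apply_eq_angleDensity hK hG hN hNω t q hk]
    exact angleDensity_eq_zero _ hkc
  refine ⟨contDiff_of_contDiffOn_of_eq_zero hG
    (hN.isCompact_sweptSupport hF₀c hF₀G).isClosed (hN.sweptSupport_subset hF₀G) ?_ hz, hz⟩
  exact hF.contDiffOn.comp (contDiff_prodMk_right t).contDiffOn fun z hz => ⟨mem_univ _, hz⟩

end ActionAngle

/-! ### Uniform bounds for the kernels as test functions, and the limit `ε → 0` -/

lemma continuous_coulombField {d : ℕ} {ε : ℝ} (hε : 0 < ε) : Continuous (coulombField d ε) := by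
  have hpos : ∀ y : Eucl d, 0 < ‖y‖ ^ 2 + ε := fun y => by positivity
  have hc : Continuous fun y : Eucl d => (‖y‖ ^ 2 + ε) ^ (-(d : ℝ) / 2) :=
    Continuous.rpow_const (by fun_prop) fun y => Or.inl (hpos y).ne'
  exact (continuous_const.mul hc).smul continuous_id

lemma contDiff_coulombKernel {d : ℕ} (hd : 1 ≤ d) {ε : ℝ} (hε : 0 < ε) :
    ContDiff ℝ 1 (coulombKernel d ε) := by
  have hpos : ∀ y : Eucl d, 0 < ‖y‖ ^ 2 + ε := fun y => by positivity
  have hf : fderiv ℝ (coulombKernel d ε) = fun y => innerSL ℝ (coulombField d ε y) :=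
    funext fun y => (hasFDerivAt_coulombKernel hd (hpos y)).fderiv
  rw [contDiff_one_iff_fderiv, hf]
  exact ⟨fun y => (hasFDerivAt_coulombKernel hd (hpos y)).differentiableAt,
    (innerSL ℝ).continuous.comp (continuous_coulombField hε)⟩

/-- Up to a constant, the regularized kernels are bounded in `W^{1,1}` of a ball, uniformly in the
regularization and in the position of the charge. -/
lemma exists_integral_coulombKernel_le {d : ℕ} (hd : 1 ≤ d) {R B : ℝ} (hR : 0 ≤ R) (hB : 0 ≤ B) :
    ∃ C : ℝ, 0 ≤ C ∧ ∀ ε ∈ Ioc (0 : ℝ) 1, ∀ x : Eucl d, ∃ c : ℝ,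
      ∫ y in Metric.closedBall (0 : Eucl d) R,
        (|coulombKernel d ε (x - y) - c| + B * ‖coulombField d ε (x - y)‖) ≤ C := by
  have : Nonempty (Fin d) := ⟨⟨0, hd⟩⟩
  obtain ⟨C₀, hC₀, hC₀b⟩ := exists_abs_coulombKernel_le hd
  obtain ⟨C₁, hC₁, hC₁b⟩ := exists_setIntegral_inv_norm_pow_le hd R
  have hcd := coulombConst_nonneg d
  set v := volume.real (Metric.closedBall (0 : Eucl d) R)
  have hv : 0 ≤ v := measureReal_nonneg
  have hfin : volume (Metric.closedBall (0 : Eucl d) R) ≠ ⊤ := measure_closedBall_lt_top.ne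
  -- `α` bounds the regular part of the kernel, `β` the coefficient of its singular part
  set α := C₀ * (2 + 3 * R) + coulombConst d * R
  set β := C₀ + B * coulombConst d
  have hα : 0 ≤ α := by positivity
  have hβ : 0 ≤ β := by positivity
  refine ⟨α * v + β * C₁, by positivity, fun ε hε x => ?_⟩
  -- For a distant observation point, `c` is the kernel at `x`: from `2 * R + 1 ≤ ‖x‖` the distance
  -- to the ball is at least `1`, and the oscillation of the kernel over the ball is bounded. For a
  -- near one, `c = 0` suffices, as `‖x - y‖ ≤ 1 + 3 * R`.
  obtain ⟨c, hc⟩ : ∃ c : ℝ, ∀ y ∈ Metric.closedBall (0 : Eucl d) R, x - y ≠ 0 →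
      |coulombKernel d ε (x - y) - c| ≤ α + C₀ * (‖x - y‖ ^ (d - 1))⁻¹ := by
    by_cases hx : 2 * R + 1 ≤ ‖x‖
    · refine ⟨coulombKernel d ε x, fun y hy _ => ?_⟩
      have h1 := abs_coulombKernel_sub_le hd hε.1.le (R := R) (x := x) (y := y)
        (by simpa using hy) (by linarith)
      have h2 : ((‖x‖ - R) ^ (d - 1))⁻¹ ≤ 1 := inv_le_one_of_one_le₀ (one_le_pow₀ (by linarith))
      have h3 : coulombConst d * ((‖x‖ - R) ^ (d - 1))⁻¹ * R ≤ coulombConst d * 1 * R := by gcongr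
      have h4 : 0 ≤ C₀ * (‖x - y‖ ^ (d - 1))⁻¹ := by positivity
      have h5 : 0 ≤ C₀ * (2 + 3 * R) := by positivity
      simp only [α]
      linarith
    · refine ⟨0, fun y hy hxy => ?_⟩
      rw [sub_zero]
      refine (hC₀b ε ⟨hε.1.le, hε.2⟩ _ hxy).trans ?_
      have hy' : ‖y‖ ≤ R := by simpa using hy
      have h1 : ‖x - y‖ ≤ 1 + 3 * R := (norm_sub_le x y).trans (by linarith)
      have h2 : coulombWeight d (x - y) ≤ (2 + 3 * R) + (‖x - y‖ ^ (d - 1))⁻¹ := by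
        unfold coulombWeight; linarith
      have h3 := mul_le_mul_of_nonneg_left h2 hC₀
      have h4 : 0 ≤ coulombConst d * R := by positivity
      simp only [α]
      linarith
  refine ⟨c, ?_⟩
  obtain ⟨hi, hle⟩ := hC₁b x
  have hci : IntegrableOn (fun _ => α) (Metric.closedBall (0 : Eucl d) R) := integrableOn_const hfin
  have hbi : IntegrableOn (fun y => α + β * (‖x - y‖ ^ (d - 1))⁻¹)
      (Metric.closedBall (0 : Eucl d) R) := hci.add (hi.const_mul β)
  have hcont : Continuous fun y =>
      |coulombKernel d ε (x - y) - c| + B * ‖coulombField d ε (x - y)‖ := by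
    have h1 := (contDiff_coulombKernel hd hε.1).continuous
    have h2 := continuous_coulombField (d := d) hε.1
    fun_prop
  have hne : ∀ᵐ y : Eucl d, y ≠ x := by simp [ae_iff]
  calc ∫ y in Metric.closedBall (0 : Eucl d) R,
        (|coulombKernel d ε (x - y) - c| + B * ‖coulombField d ε (x - y)‖)
      ≤ ∫ y in Metric.closedBall (0 : Eucl d) R, (α + β * (‖x - y‖ ^ (d - 1))⁻¹) := by
        refine setIntegral_mono_on_ae
          (hcont.continuousOn.integrableOn_compact (isCompact_closedBall _ _)) hbi
          measurableSet_closedBall ?_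
        filter_upwards [hne] with y hy hyR
        have h1 := hc y hyR (sub_ne_zero.2 (Ne.symm hy))
        have h2 := mul_le_mul_of_nonneg_left (norm_coulombField_le hd hε.1.le (x - y)) hB
        simp only [β]
        linarith
    _ = α * v + β * ∫ y in Metric.closedBall (0 : Eucl d) R, (‖x - y‖ ^ (d - 1))⁻¹ := by
        rw [integral_add hci (hi.const_mul β), integral_const_mul]
        simp [v, mul_comm]
    _ ≤ _ := by gcongr

lemma integral_mul_spatialDensity {d : ℕ} {F : Phase d → ℝ} (hF : Continuous F)
    (hFc : HasCompactSupport F) {u : Eucl d → ℝ} (hu : Continuous u) :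
    ∫ y, u y * spatialDensity F y = ∫ z : Phase d, u z.1 * F z := by
  have hi : Integrable (fun z : Phase d => u z.1 * F z) :=
    (Continuous.mul (by fun_prop) hF).integrable_of_hasCompactSupport hFc.mul_left
  rw [Measure.volume_eq_prod] at hi ⊢
  rw [integral_prod _ hi]
  refine integral_congr_ae (ae_of_all _ fun y => ?_)
  simp only [spatialDensity]
  rw [integral_const_mul]

/-- The difference of two potentials is the limit of the differences of the regularized ones. -/
lemma abs_coulombPotential_sub_le_of_regularized {d : ℕ} (hd : 1 ≤ d) {ρ σ : Eucl d → ℝ}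
    (hρ : Continuous ρ) (hρc : HasCompactSupport ρ) (hσ : Continuous σ)
    (hσc : HasCompactSupport σ) {x : Eucl d} {b : ℝ}
    (hb : ∀ ε ∈ Ioc (0 : ℝ) 1, |∫ y, coulombKernel d ε (x - y) * (ρ y - σ y)| ≤ b) :
    |coulombPotential ρ x - coulombPotential σ x| ≤ b := by
  have : Nonempty (Fin d) := ⟨⟨0, hd⟩⟩
  obtain ⟨C, hC, hCb⟩ := exists_abs_coulombKernel_le hd
  have hεmem : ∀ n : ℕ, 1 / ((n : ℝ) + 1) ∈ Ioc (0 : ℝ) 1 := fun n =>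
    ⟨by positivity, by rw [div_le_one (by positivity)]; linarith [n.cast_nonneg (α := ℝ)]⟩
  have h0 : ∀ᵐ y : Eucl d, y ≠ 0 := by simp [ae_iff]
  set τ : Eucl d → ℝ := fun y => ρ (x - y) - σ (x - y) with hτ
  have c1 : Continuous τ := by fun_prop
  have s1 : HasCompactSupport τ := (hρc.comp_const_sub x).sub (hσc.comp_const_sub x)
  have hk := locallyIntegrable_coulombKernel hd (ε := 0) ⟨le_rfl, zero_le_one⟩
  have heq : coulombPotential ρ x - coulombPotential σ x = ∫ y, coulombKernel d 0 y * τ y := by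
    rw [coulombPotential, coulombPotential, ← integral_sub
      (integrable_mul_of_locallyIntegrable hk (by fun_prop) (hρc.comp_const_sub x))
      (integrable_mul_of_locallyIntegrable hk (by fun_prop) (hσc.comp_const_sub x))]
    simp only [hτ, mul_sub]
  have heqn : ∀ ε, ∫ y, coulombKernel d ε (x - y) * (ρ y - σ y) =
      ∫ y, coulombKernel d ε y * τ y := fun ε => by
    rw [← integral_sub_left_eq_self (fun y => coulombKernel d ε y * τ y) volume x]
    simp [hτ]
  have t1 : Tendsto (fun n : ℕ => ∫ y, coulombKernel d (1 / ((n : ℝ) + 1)) y * τ y) atTop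
      (𝓝 (∫ y, coulombKernel d 0 y * τ y)) := by
    refine tendsto_integral_of_dominated_convergence
      (fun y => C * ‖coulombWeight d y * τ y‖)
      (fun n => ((measurable_coulombKernel d _).mul c1.measurable).aestronglyMeasurable)
      ((integrable_mul_of_locallyIntegrable (locallyIntegrable_coulombWeight hd) c1
        s1).norm.const_mul C) (fun n => ?_) ?_
    · filter_upwards [h0] with y hy
      rw [norm_mul, norm_mul, ← mul_assoc, Real.norm_of_nonneg (coulombWeight_nonneg d y)]
      exact mul_le_mul_of_nonneg_right (hCb _ ⟨(hεmem n).1.le, (hεmem n).2⟩ y hy) (norm_nonneg _)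
    · filter_upwards [h0] with y hy
      exact (coulombKernel_tendsto hd hy).mul_const _
  rw [heq]
  refine le_of_tendsto t1.abs (Eventually.of_forall fun n => ?_)
  rw [← heqn]
  exact hb _ (hεmem n)

/-! ### Mixing in phase space and convergence of the potentials -/

section Convergence

variable {d : ℕ} {K : Set (Eucl d)} {G : Set (Phase d)} {U : Eucl d → ℝ} {ω : Eucl d → Eucl d}
  {N : OpenPartialHomeomorph (Torus d × Eucl d) (Phase d)} {F₀ : Phase d → ℝ}
  {F : ℝ → Phase d → ℝ}

/-- Phase mixing for the Liouville equation, tested against functions of the position. -/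
lemma exists_liouville_mixing (hK : IsOpen K) (hG : IsOpen G)
    (hω : ContDiffOn ℝ 2 ω K) (hdet : ∀ k ∈ K, (fderiv ℝ ω k).det ≠ 0)
    (hN : IsC1Diffeo N K G) (hNω : IsActionAngle U ω N K) (hF₀ : ContDiff ℝ 1 F₀)
    (hF₀c : HasCompactSupport F₀) (hF₀G : tsupport F₀ ⊆ G)
    (hF : IsLiouvilleSolution U G F₀ F) :
    ∃ C R B : ℝ, 0 ≤ C ∧ 0 ≤ R ∧ 0 ≤ B ∧ ∀ (t : ℝ) (u : Eucl d → ℝ) (c : ℝ), ContDiff ℝ 1 u →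
      (1 + |t|) * |∫ z : Phase d, u z.1 * (F t z - averagedDensity N F₀ z)| ≤
        C * ∫ y in Metric.closedBall (0 : Eucl d) R, (|u y - c| + B * ‖fderiv ℝ u y‖) := by
  set fT := angleDensity N F₀ with hfT
  set Kc := actionSupport N F₀ with hKcdef
  have hKc : IsCompact Kc := hN.isCompact_actionSupport hF₀c hF₀G
  have hKcK : Kc ⊆ K := hN.actionSupport_subset hF₀G
  have hfTc : Continuous fT := hN.continuous_angleDensity hF₀.continuous hF₀c hF₀G
  have hf : ContDiff ℝ 1 (torusLift fT) :=
    hN.contDiff_torusLift_angleDensity hK hF₀ hF₀c hF₀G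
  have hfTK : ∀ τ, ∀ k ∉ Kc, fT (τ, k) = 0 := fun τ k hk => angleDensity_eq_zero τ hk
  have hav : Continuous (angleAverage fT) := (contDiff_angleAverage hfTc hf).continuous
  obtain ⟨A, hA₁, hA₂⟩ := hN.exists_bound_angleDensity hK hF₀ hF₀c hF₀G
  have hA : 0 ≤ A := (abs_nonneg _).trans (hA₁ 0)
  -- The last argument is a bound for the norm on the period cell, so that every shift needed for
  -- the average is covered.
  obtain ⟨K₁, Ω, w, a, hK₁, hKcK₁, hK₁K, hΩ, hΩω, hw⟩ :=
    exists_frequency_fields hK hKc hKcK hω hdet √(d * (2 * π) ^ 2)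
  have ha : 0 ≤ a := (norm_nonneg _).trans (hw 0 (by rw [norm_zero]; exact Real.sqrt_nonneg _)).2.2.2.2.2
  -- A second cutoff, equal to `1` on `K₁`, leaves the position unchanged on all actions over which
  -- the mixing bound integrates.
  obtain ⟨K₂, χ, hK₂, hK₁K₂, hK₂K, hχ, hχ1, hχ0⟩ := exists_cutoff hK₁ hK hK₁K
  -- the position as a globally defined function of the angles and the actions
  set X : Eucl d × Eucl d → Eucl d := fun y => χ y.2 • (torusLift N y).1 with hX
  have hXC : ContDiff ℝ 1 X := by
    refine contDiff_of_contDiffOn_of_eq_zero (isOpen_univ.prod hK)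
      (isClosed_univ.prod hK₂.isClosed) (prod_mono_right hK₂K)
      ((hχ.comp contDiff_snd).contDiffOn.smul (contDiff_fst.comp_contDiffOn hN.contDiffOn_lift))
      fun y hy => ?_
    simp [hX, hχ0 y.2 fun h => hy ⟨mem_univ _, h⟩]
  have hX1 : ∀ y : Eucl d × Eucl d, y.2 ∈ K₁ → X y = (torusLift N y).1 := fun y hy => by
    simp [hX, hχ1.self_of_nhdsSet y.2 hy]
  set Q := torusBox d
  have hQ := measurableSet_torusBox d
  have hQb := isBounded_torusBox d
  have hQKb : Bornology.IsBounded (Q ×ˢ K₁) := hQb.prod hK₁.isBounded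
  obtain ⟨B, hB⟩ := hQKb.isCompact_closure.exists_bound_of_continuousOn
    (hXC.continuous_fderiv one_ne_zero).continuousOn
  have hB' : ∀ y ∈ Q ×ˢ K₁, ‖fderiv ℝ X y‖ ≤ max B 0 := fun y hy =>
    (hB y (subset_closure hy)).trans (le_max_left _ _)
  have hTK₁ : IsCompact (N '' (univ ×ˢ K₁)) := by
    refine (isCompact_univ.prod hK₁).image_of_continuousOn (N.continuousOn.mono ?_)
    rw [hN.source_eq]
    exact prod_mono_right hK₁K
  obtain ⟨R', hR'⟩ := hTK₁.isBounded.subset_closedBall 0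
  set R := max R' 0
  set v := volume.real (Metric.closedBall (0 : Eucl d) R)
  have hv : 0 ≤ v := measureReal_nonneg
  -- The factor `v` comes from integrating over the momenta, on which the test function does not
  -- depend.
  refine ⟨(d + 2) * A * a * v, R, max B 0, by positivity, le_max_right _ _, le_max_right _ _,
    fun t u c hu => ?_⟩
  have huc := hu.continuous
  have hud : Continuous (fderiv ℝ u) := hu.continuous_fderiv one_ne_zero
  obtain ⟨hFt, hFt0⟩ := hF.regular hK hG hN hNω hF₀c hF₀G t
  obtain ⟨hFa, hFa0⟩ := hN.averagedDensity_regular hK hG hF₀ hF₀c hF₀G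
  have hSG := hN.sweptSupport_subset hF₀G
  -- pass to angle-action variables
  set g : Eucl d × Eucl d → ℝ := fun z =>
    torusLift fT (z.1 - t • Ω z.2, z.2) - angleAverage fT z.2 with hg
  have hΩc := hΩ.continuous
  have hp := continuous_torusProj d
  have hg1 : Continuous fun z : Eucl d × Eucl d => torusLift fT (z.1 - t • Ω z.2, z.2) :=
    hf.continuous.comp (by fun_prop)
  have hg2 : Continuous fun z : Eucl d × Eucl d => angleAverage fT z.2 := by fun_prop
  have hg10 : ∀ z : Eucl d × Eucl d, z.2 ∉ Kc → torusLift fT (z.1 - t • Ω z.2, z.2) = 0 :=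
    fun z hz => hfTK _ _ hz
  have hg20 : ∀ z : Eucl d × Eucl d, z.2 ∉ Kc → angleAverage fT z.2 = 0 := fun z hz => by
    simp [angleAverage, hfTK _ _ hz]
  have hXc := hXC.continuous
  set h : Eucl d × Eucl d → ℝ := fun z => u (X z) - c with hh
  have hhC : ContDiff ℝ 1 h := (hu.comp hXC).sub contDiff_const
  have e1 : ∫ z : Phase d, u z.1 * (F t z - averagedDensity N F₀ z) =
      ∫ y in Q ×ˢ univ, u (X y) * g y := by
    rw [← setIntegral_eq_integral_of_forall_compl_eq_zero (s := G) fun z hz => by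
      rw [hFt0 z fun h => hz (hSG h), hFa0 z fun h => hz (hSG h), sub_zero, mul_zero]]
    rw [← hN.image_box, hN.setIntegral_image hK hNω (hQ.prod hK.measurableSet) subset_rfl]
    have : ∫ y in Q ×ˢ univ, u (X y) * g y = ∫ y in Q ×ˢ K, u (X y) * g y := by
      refine setIntegral_eq_of_subset_of_forall_sdiff_eq_zero (hQ.prod MeasurableSet.univ)
        (prod_mono_right (subset_univ _)) fun y hy => ?_
      have hyc : y.2 ∉ Kc := fun hk => hy.2 ⟨hy.1.1, hKcK hk⟩
      simp only [hg]
      rw [hg10 y hyc, hg20 y hyc, sub_zero, mul_zero]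
    rw [this]
    refine setIntegral_congr_fun (hQ.prod hK.measurableSet) fun y hy => ?_
    obtain ⟨q, k⟩ := y
    have hk : k ∈ K := hy.2
    simp only [hg]
    rw [hF.apply_eq_angleDensity hK hG hN hNω t q hk, hN.averagedDensity_torusLift q hk]
    -- The cut-off frequency and position agree with the true ones on `Kc`; at all other actions
    -- both densities vanish.
    by_cases hkc : k ∈ Kc
    · rw [hX1 (q, k) (hKcK₁ hkc), hΩω k hkc]
    · have a1 : torusLift (angleDensity N F₀) (q - t • ω k, k) = 0 := hfTK _ _ hkc
      rw [a1, hg10 (q, k) hkc, hg20 (q, k) hkc]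
      simp
  have i1 : IntegrableOn (fun z => h z * torusLift fT (z.1 - t • Ω z.2, z.2))
      (Q ×ˢ (univ : Set (Eucl d))) :=
    (hhC.continuous.mul hg1).integrableOn_strip hQ hQb hKc fun z hz => by
      show h z * torusLift fT (z.1 - t • Ω z.2, z.2) = 0
      rw [hg10 z hz, mul_zero]
  have i2 : IntegrableOn (fun z => h z * angleAverage fT z.2) (Q ×ˢ (univ : Set (Eucl d))) :=
    (hhC.continuous.mul hg2).integrableOn_strip hQ hQb hKc fun z hz => by
      show h z * angleAverage fT z.2 = 0
      rw [hg20 z hz, mul_zero]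
  have i3 : IntegrableOn (fun z : Eucl d × Eucl d => torusLift fT (z.1 - t • Ω z.2, z.2))
      (Q ×ˢ (univ : Set (Eucl d))) := hg1.integrableOn_strip hQ hQb hKc hg10
  have i4 : IntegrableOn (fun z : Eucl d × Eucl d => angleAverage fT z.2)
      (Q ×ˢ (univ : Set (Eucl d))) := hg2.integrableOn_strip hQ hQb hKc hg20
  have e2 : ∫ y in Q ×ˢ univ, u (X y) * g y =
      (∫ z in Q ×ˢ univ, h z * torusLift fT (z.1 - t • Ω z.2, z.2)) -
        ∫ z in Q ×ˢ univ, h z * angleAverage fT z.2 := by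
    have hmass := integral_shift_eq_integral_angleAverage hfTc hKc hfTK hav hΩc t
    -- Both densities have the same mass, so the constant `c` can be subtracted from the test
    -- function without changing the integral.
    have hg0 : ∫ y in Q ×ˢ univ, g y = 0 := by
      simp only [hg]
      rw [integral_sub i3 i4, hmass, sub_self]
    rw [← integral_sub i1 i2]
    have : ∀ y, u (X y) * g y = (h y * torusLift fT (y.1 - t • Ω y.2, y.2) -
        h y * angleAverage fT y.2) + c * g y := fun y => by simp only [hh, hg]; ring
    simp only [this]
    have i5 : IntegrableOn (fun y => h y * torusLift fT (y.1 - t • Ω y.2, y.2) -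
      h y * angleAverage fT y.2) (Q ×ˢ (univ : Set (Eucl d))) := i1.sub i2
    have i6 : IntegrableOn (fun y => c * g y) (Q ×ˢ (univ : Set (Eucl d))) :=
      (i3.sub i4).const_mul c
    rw [integral_add i5 i6, integral_const_mul, hg0, mul_zero,
      add_zero]
  set S := ∫ z in Q ×ˢ K₁, (|h z| + ‖fderiv ℝ h z‖) with hS
  have ht : 0 < 1 + |t| := by positivity
  have hmix : |(∫ z in Q ×ˢ univ, h z * torusLift fT (z.1 - t • Ω z.2, z.2)) -
        ∫ z in Q ×ˢ univ, h z * angleAverage fT z.2| ≤ ((d + 2) * A * a * S) / (1 + |t|) := by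
    refine abs_integral_sub_angleAverage_le hfTc hKc hfTK hhC.continuous hΩc fun e he => ?_
    obtain ⟨hw1, hw2, hw3, hw4, hw5, hw6⟩ := hw e (norm_le_of_mem_torusBox he)
    rw [le_div_iff₀' ht]
    exact abs_integral_shift_sub_le hf hhC hΩ hw1 hQ hQb hKc hK₁ hKcK₁ hw2
      (fun y k hk => hfTK _ k hk) hw3 hA₁ hA₂ hw4 hw5 hw6 t
  rw [e1, e2, ← le_div_iff₀' ht]
  refine hmix.trans ?_
  refine div_le_div_of_nonneg_right ?_ ht.le
  rw [mul_assoc _ v]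
  refine mul_le_mul_of_nonneg_left ?_ (by positivity)
  -- push the bound forward to phase space
  set H : Eucl d → ℝ := fun y => |u y - c| + max B 0 * ‖fderiv ℝ u y‖ with hH
  have hHc : Continuous H := by fun_prop
  have hH0 : ∀ y, 0 ≤ H y := fun y => add_nonneg (abs_nonneg _)
    (mul_nonneg (le_max_right _ _) (norm_nonneg _))
  have hSc : Continuous fun z => |h z| + ‖fderiv ℝ h z‖ := by
    have h1 := hhC.continuous
    have h2 : Continuous (fderiv ℝ h) := hhC.continuous_fderiv one_ne_zero
    fun_prop
  have hm : MeasurableSet (Q ×ˢ K₁) := hQ.prod hK₁.measurableSet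
  have hint : ∀ {p : Eucl d × Eucl d → ℝ}, Continuous p → IntegrableOn p (Q ×ˢ K₁) := fun hp =>
    (hp.continuousOn.integrableOn_compact hQKb.isCompact_closure).mono_set subset_closure
  calc S ≤ ∫ y in Q ×ˢ K₁, H (X y) := by
        refine setIntegral_mono_on (hint hSc) (hint (hHc.comp hXc)) hm fun y hy => ?_
        simp only [hH, hh]
        refine add_le_add le_rfl ?_
        have h1 : HasFDerivAt h ((fderiv ℝ u (X y)).comp (fderiv ℝ X y)) y :=
          (((hu.differentiable one_ne_zero) (X y)).hasFDerivAt.comp y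
            ((hXC.differentiable one_ne_zero) y).hasFDerivAt).sub_const c
        rw [h1.fderiv]
        refine (ContinuousLinearMap.opNorm_comp_le _ _).trans ?_
        rw [mul_comm]
        exact mul_le_mul_of_nonneg_right (hB' y hy) (norm_nonneg _)
    _ = ∫ y in Q ×ˢ K₁, H (torusLift N y).1 :=
        setIntegral_congr_fun hm fun y hy => by simp only [hX1 y hy.2]
    _ = ∫ z in torusLift N '' (Q ×ˢ K₁), H z.1 :=
        (hN.setIntegral_image hK hNω hm (prod_mono_right hK₁K) fun z => H z.1).symm
    -- The integrand is nonnegative, so the image of the cell may be enlarged to a product of balls,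
    -- where the integral factorizes.
    _ ≤ ∫ z in Metric.closedBall (0 : Eucl d) R ×ˢ Metric.closedBall (0 : Eucl d) R, H z.1 := by
        have hc1 : IsCompact (Metric.closedBall (0 : Eucl d) R ×ˢ Metric.closedBall (0 : Eucl d) R) :=
          (isCompact_closedBall _ _).prod (isCompact_closedBall _ _)
        refine setIntegral_mono_set ((hHc.comp continuous_fst).continuousOn.integrableOn_compact hc1)
          (ae_of_all _ fun z => hH0 z.1) (LE.le.eventuallyLE ?_)
        rintro _ ⟨y, hy, rfl⟩
        have h1 : torusLift N y ∈ Metric.closedBall (0 : Phase d) R' :=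
          hR' ⟨(torusProj d y.1, y.2), ⟨mem_univ _, hy.2⟩, rfl⟩
        have h2 : ‖torusLift N y‖ ≤ R := (by simpa using h1 : _ ≤ R').trans (le_max_left _ _)
        exact ⟨by simpa using (norm_fst_le _).trans h2, by simpa using (norm_snd_le _).trans h2⟩
    _ = v * ∫ y in Metric.closedBall (0 : Eucl d) R, H y := by
        rw [Measure.volume_eq_prod]
        have := setIntegral_prod_mul (μ := (volume : Measure (Eucl d)))
          (ν := (volume : Measure (Eucl d))) H (fun _ => (1 : ℝ))
          (Metric.closedBall (0 : Eucl d) R) (Metric.closedBall (0 : Eucl d) R)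
        simp only [mul_one] at this
        rw [this, mul_comm]
        simp [v]

/-- The Coulomb potentials converge uniformly, with rate `1 / t`. -/
lemma exists_abs_coulombPotential_sub_le (hd : 1 ≤ d) (hK : IsOpen K) (hG : IsOpen G)
    (hω : ContDiffOn ℝ 2 ω K) (hdet : ∀ k ∈ K, (fderiv ℝ ω k).det ≠ 0)
    (hN : IsC1Diffeo N K G) (hNω : IsActionAngle U ω N K) (hF₀ : ContDiff ℝ 1 F₀)
    (hF₀c : HasCompactSupport F₀) (hF₀G : tsupport F₀ ⊆ G)
    (hF : IsLiouvilleSolution U G F₀ F) :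
    ∃ C : ℝ, ∀ (t : ℝ) (x : Eucl d), |coulombPotential (spatialDensity (F t)) x -
      coulombPotential (spatialDensity (averagedDensity N F₀)) x| ≤ C / (1 + |t|) := by
  obtain ⟨C, R, B, hC, hR, hB, hmix⟩ :=
    exists_liouville_mixing hK hG hω hdet hN hNω hF₀ hF₀c hF₀G hF
  obtain ⟨C', hC', hker⟩ := exists_integral_coulombKernel_le hd hR hB
  refine ⟨C * C', fun t x => ?_⟩
  have hS := hN.isCompact_sweptSupport hF₀c hF₀G
  obtain ⟨hFt, hFt0⟩ := hF.regular hK hG hN hNω hF₀c hF₀G t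
  obtain ⟨hFa, hFa0⟩ := hN.averagedDensity_regular hK hG hF₀ hF₀c hF₀G
  have hFtc := HasCompactSupport.intro hS hFt0
  have hFac := HasCompactSupport.intro hS hFa0
  obtain ⟨hρ, hρc⟩ := spatialDensity_contDiff hFt hFtc
  obtain ⟨hσ, hσc⟩ := spatialDensity_contDiff hFa hFac
  refine abs_coulombPotential_sub_le_of_regularized hd hρ.continuous hρc hσ.continuous hσc
    fun ε hε => ?_
  have hΦ := contDiff_coulombKernel hd hε.1
  have hu : ContDiff ℝ 1 fun y => coulombKernel d ε (x - y) :=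
    hΦ.comp (contDiff_const.sub contDiff_id)
  obtain ⟨c, hc⟩ := hker ε hε x
  -- The test function is the regularized kernel seen from `x`, with the constant `c` adapted to
  -- `x`; its `W^{1,1}` bound depends neither on `x` nor on `ε`.
  have key := hmix t (fun y => coulombKernel d ε (x - y)) c hu
  have hfd : ∀ y, ‖fderiv ℝ (fun y => coulombKernel d ε (x - y)) y‖ =
      ‖coulombField d ε (x - y)‖ := fun y => by
    have hpos : 0 < ‖x - y‖ ^ 2 + ε := by have := hε.1; positivity
    rw [fderiv_comp_const_sub hΦ, norm_neg, (hasFDerivAt_coulombKernel hd hpos).fderiv,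
      innerSL_apply_norm]
  simp only [hfd] at key
  have huc := hu.continuous
  have e : ∫ y, coulombKernel d ε (x - y) *
        (spatialDensity (F t) y - spatialDensity (averagedDensity N F₀) y) =
      ∫ z : Phase d, coulombKernel d ε (x - z.1) * (F t z - averagedDensity N F₀ z) := by
    have j1 : Integrable fun y => coulombKernel d ε (x - y) * spatialDensity (F t) y :=
      (huc.mul hρ.continuous).integrable_of_hasCompactSupport hρc.mul_left
    have j2 : Integrable fun y =>
        coulombKernel d ε (x - y) * spatialDensity (averagedDensity N F₀) y :=
      (huc.mul hσ.continuous).integrable_of_hasCompactSupport hσc.mul_left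
    have j3 : Integrable fun z : Phase d => coulombKernel d ε (x - z.1) * F t z :=
      ((huc.comp continuous_fst).mul hFt.continuous).integrable_of_hasCompactSupport hFtc.mul_left
    have j4 : Integrable fun z : Phase d =>
        coulombKernel d ε (x - z.1) * averagedDensity N F₀ z :=
      ((huc.comp continuous_fst).mul hFa.continuous).integrable_of_hasCompactSupport hFac.mul_left
    simp only [mul_sub]
    rw [integral_sub j1 j2, integral_mul_spatialDensity hFt.continuous hFtc huc,
      integral_mul_spatialDensity hFa.continuous hFac huc, ← integral_sub j3 j4]
  rw [e, le_div_iff₀' (by positivity)]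
  exact key.trans (mul_le_mul_of_nonneg_left hc hC)

end Convergence

end

/-! ### The main theorem -/

theorem corollary1 (d : ℕ) (hd : 1 ≤ d)
    (K : Set (Eucl d)) (hK : IsOpen K) (G : Set (Phase d)) (hG : IsOpen G)
    -- the external potential, where it is needed
    (U : Eucl d → ℝ) (hU : ContDiffOn ℝ 1 U (Prod.fst '' G))
    -- the frequencies and the non-degeneracy condition
    (ω : Eucl d → Eucl d) (hω : ContDiffOn ℝ 2 ω K) (hdet : ∀ k ∈ K, (fderiv ℝ ω k).det ≠ 0)
    -- the action-angle map
    (N : OpenPartialHomeomorph (Torus d × Eucl d) (Phase d))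
    (hN : IsC1Diffeo N K G) (hNω : IsActionAngle U ω N K)
    -- the initial datum and the solution
    (F₀ : Phase d → ℝ) (hF₀ : ContDiff ℝ 1 F₀) (hF₀c : HasCompactSupport F₀)
    (hF₀G : tsupport F₀ ⊆ G)
    (F : ℝ → Phase d → ℝ) (hF : IsLiouvilleSolution U G F₀ F) :
    -- the Coulomb potentials are well defined
    (∀ t : ℝ, ∃! V : Eucl d → ℝ, IsCoulombPotential (F t) V) ∧
    (∃! V : Eucl d → ℝ, IsCoulombPotential (averagedDensity N F₀) V) ∧
    -- uniform convergence with rate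
    ∃ C : ℝ, ∀ (t : ℝ) (V W : Eucl d → ℝ),
      IsCoulombPotential (F t) V → IsCoulombPotential (averagedDensity N F₀) W →
        ∀ x : Eucl d, |V x - W x| ≤ C / (1 + |t|) := by
  have hS := hN.isCompact_sweptSupport hF₀c hF₀G
  have hFt := fun t => (hF.regular hK hG hN hNω hF₀c hF₀G t).1
  have hFtc := fun t => HasCompactSupport.intro hS (hF.regular hK hG hN hNω hF₀c hF₀G t).2
  obtain ⟨hFa, hFa0⟩ := hN.averagedDensity_regular hK hG hF₀ hF₀c hF₀G
  have hFac := HasCompactSupport.intro hS hFa0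
  refine ⟨fun t => existsUnique_isCoulombPotential hd (hFt t) (hFtc t),
    existsUnique_isCoulombPotential hd hFa hFac, ?_⟩
  obtain ⟨C, hC⟩ := exists_abs_coulombPotential_sub_le hd hK hG hω hdet hN hNω hF₀ hF₀c hF₀G hF
  -- In dimension one the normalization subtracts the value of the convolution at the origin, which
  -- differs between the two densities by at most the same bound; hence the factor `2`.
  refine ⟨2 * C, fun t V W hV hW x => ?_⟩
  obtain ⟨hρ, hρc⟩ := spatialDensity_contDiff (hFt t) (hFtc t)
  obtain ⟨hσ, hσc⟩ := spatialDensity_contDiff hFa hFac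
  rw [hV.unique hd (isCoulombPotential_coulombPotential hd hρ hρc),
    hW.unique hd (isCoulombPotential_coulombPotential hd hσ hσc)]
  have h1 := hC t x
  have h2 : |coulombOffset (spatialDensity (F t)) -
      coulombOffset (spatialDensity (averagedDensity N F₀))| ≤ C / (1 + |t|) := by
    unfold coulombOffset
    split_ifs
    · exact hC t 0
    · simpa using (abs_nonneg _).trans h1
  rw [sub_sub_sub_comm]
  refine (abs_sub _ _).trans ((add_le_add h1 h2).trans (le_of_eq ?_))
  ring
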